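/- **Pin sequences.** A *pin sequence* is an infinite word $w=w_1w_2\cdots$ over the letters $x_y$, where $x,y\in\{\mathsf l,\mathsf r,\mathsf u,\mathsf d\}$ (left, right, up, down) and exactly one of $x,y$ is horizontal, such that the subscript of $w_{i+1}$ is the main symbol of $w_i$ for all $i\ge 1$. It defines points $p_1,p_2,\dots$ in the plane, gridded by the two coordinate axes, as follows. If $w_1=x_y$, then $p_1$ lies in the quadrant given by the directions $x$ and $y$. For $i\geq 1$, if $w_{i+1}=x_y$, then $p_{i+1}$ lies in direction $x$ outside the rectangular hull of $\{0,p_1,\dots,p_i\}$, and in the coordinate of direction $y$ it lies strictly between $p_i$ and $\{0,p_1,\dots,p_{i-1}\}$. This determines the infinite gridded permutation $\pi_w$ of the points $p_1,p_2,\dots$. The *pin class* $\mathcal C_w$ is the set of all finite gridded permutations contained in $\pi_w$, where containment preserves the order of both coordinates and the quadrants. Its growth rate is $\mathrm{gr}(\mathcal C_w)=\lim_{n\to\infty}|\mathcal C_{w,n}|^{1/n}$, where $\mathcal C_{w,n}$ is the set of members of length $n$. The sequence $w$ *visits only quadrants 1 and 2* if every $p_i$ lies in quadrant 1 or 2. A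 finite word is a *recurrent factor* of $w$ if it occurs in $w$ as a contiguous factor at infinitely many positions. Subscripts that are determined by the rest of the word are omitted. Let $w_{2,2}=(\mathsf l\mathsf u\mathsf l\mathsf u\mathsf r\mathsf u\mathsf r\mathsf u)^\infty$ (with first letter $\mathsf l_{\mathsf u}$) and $\nu_{2,2}=\mathrm{gr}(\mathcal C_{w_{2,2}})$. **Proposition 4.5.** The growth rate $\nu_{2,2}$ exists; it is the largest real zero of $z^4-3z^3-4z-2$, and $\nu_{2,2}\approx 3.39752$. Let $w$ be a pin sequence which visits only quadrants 1 and 2 and in which both $\mathsf r\mathsf u\mathsf r$ and $\mathsf l\mathsf u\mathsf l$ (that is, $\mathsf r_{\mathsf u}\mathsf u_{\mathsf r}\mathsf r_{\mathsf u}$ and $\mathsf l_{\mathsf u}\mathsf u_{\mathsf l}\mathsf l_{\mathsf u}$) are recurrent factors. Then $\mathrm{gr}(\mathcal C_w)$ exists and $\mathrm{gr}(\mathcal C_w)\ge\nu_{2,2}$, with equality if and only if $w$ is eventually equal to $w_{2,2}$, that is, $w=u\,w_{2,2}$ for some finite (possibly empty) word $u$. -/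

import Mathlib

open Filter Topology

/-- The four directions of a pin. -/
inductive PinDir
  | left | right | up | down
  deriving DecidableEq

/-- The unit vector of a direction. -/
def PinDir.vec : PinDir → ℤ × ℤ
  | .left => (-1, 0)
  | .right => (1, 0)
  | .up => (0, 1)
  | .down => (0, -1)

/-- The coordinate of a point along a direction (scalar product with the unit vector). -/
def PinDir.along (d : PinDir) (p : ℤ × ℤ) : ℤ := d.vec.1 * p.1 + d.vec.2 * p.2

/-- Left and right are horizontal, up and down are not. -/
def PinDir.IsHorizontal : PinDir → Prop
  | .left | .right => True
  | .up | .down => False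

/-- A letter of the memory encoding: the direction `dir` of a pin, together with (as the
subscript) the direction `mem` of the previous pin.  The eight letters are those in which exactly
one of the two directions is horizontal, see `IsPinSequence`. -/
@[ext] structure PinLetter where
  dir : PinDir
  mem : PinDir

/-- The letter `l_u`: a left pin that follows an up pin. -/
abbrev PinLetter.lu : PinLetter := ⟨.left, .up⟩
/-- The letter `r_u`: a right pin that follows an up pin. -/
abbrev PinLetter.ru : PinLetter := ⟨.right, .up⟩
/-- The letter `u_l`: an up pin that follows a left pin. -/
abbrev PinLetter.ul : PinLetter := ⟨.up, .left⟩
/-- The letter `u_r`: an up pin that follows a right pin. -/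
abbrev PinLetter.ur : PinLetter := ⟨.up, .right⟩

/-- An infinite pin word in the memory encoding (letters indexed from `0`): in every letter exactly
one of the direction and the subscript is horizontal, and every subscript is the direction of the
preceding pin. -/
def IsPinSequence (w : ℕ → PinLetter) : Prop :=
  (∀ i, (w i).dir.IsHorizontal ↔ ¬ (w i).mem.IsHorizontal) ∧ ∀ i, (w (i + 1)).mem = (w i).dir

/-- The points of the infinite gridded pin permutation `π_w`; the grid lines are the coordinate
axes.  Pin number `i` lies at distance `2 i + 4` in its own direction (beyond everything before it)
and at distance `2 i + 1` in the direction of the previous pin (just closer to the axis than that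
pin).  By `pinPoint_isProperPin` these are the pins described by the word. -/
def pinPoint (w : ℕ → PinLetter) (i : ℕ) : ℤ × ℤ :=
  ((2 * i + 4) * (w i).dir.vec.1 + (2 * i + 1) * (w i).mem.vec.1,
   (2 * i + 4) * (w i).dir.vec.2 + (2 * i + 1) * (w i).mem.vec.2)

/-- Every pin after the first lies, in its own direction, outside the rectangular hull of the origin
and all earlier pins, and it separates the previous pin from the origin and all other earlier
pins. -/
theorem pinPoint_isProperPin {w : ℕ → PinLetter} (hw : IsPinSequence w) (k : ℕ) :
    (0 < (w (k + 1)).dir.along (pinPoint w (k + 1)) ∧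
      ∀ j ≤ k, (w (k + 1)).dir.along (pinPoint w j) <
        (w (k + 1)).dir.along (pinPoint w (k + 1))) ∧
    (0 < (w k).dir.along (pinPoint w (k + 1)) ∧
      (∀ j < k, (w k).dir.along (pinPoint w j) < (w k).dir.along (pinPoint w (k + 1))) ∧
      (w k).dir.along (pinPoint w (k + 1)) < (w k).dir.along (pinPoint w k)) := by
  obtain ⟨h1, h2⟩ := hw
  have key : ∀ (d : PinDir) (j : ℕ), d.along (pinPoint w j) ≤ 2 * j + 4 := by
    intro d j
    have := h1 j
    revert this
    cases d <;> rcases hj : w j with ⟨a, b⟩ <;> cases a <;> cases b <;>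
      simp [PinDir.along, pinPoint, hj, PinDir.vec, PinDir.IsHorizontal] <;> omega
  have e1 : ∀ j, (w j).dir.along (pinPoint w j) = 2 * j + 4 := by
    intro j
    have := h1 j
    revert this
    rcases hj : w j with ⟨a, b⟩
    cases a <;> cases b <;>
      simp [PinDir.along, pinPoint, hj, PinDir.vec, PinDir.IsHorizontal]
  have e2 : ∀ j, (w j).mem.along (pinPoint w j) = 2 * j + 1 := by
    intro j
    have := h1 j
    revert this
    rcases hj : w j with ⟨a, b⟩
    cases a <;> cases b <;>
      simp [PinDir.along, pinPoint, hj, PinDir.vec, PinDir.IsHorizontal]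
  have e3 := e1 (k + 1)
  have e4 := e2 (k + 1)
  have e5 := e1 k
  rw [h2 k] at e4
  refine ⟨⟨by omega, fun j hj => ?_⟩, by omega, fun j hj => ?_, by omega⟩
  · have := key (w (k + 1)).dir j
    omega
  · have := key (w k).dir j
    omega

/-- The quadrant, numbered as usual, of a point that lies on neither axis. -/
def quadrant (p : ℤ × ℤ) : ℕ :=
  if 0 < p.2 then (if 0 < p.1 then 1 else 2) else (if p.1 < 0 then 3 else 4)

/-- The finite word `f` is a recurrent factor of `w`: it occurs in `w` at infinitely many
positions. -/
def IsRecurrentFactor (f : List PinLetter) (w : ℕ → PinLetter) : Prop :=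
  {i : ℕ | ∀ (j : ℕ) (hj : j < f.length), w (i + j) = f[j]}.Infinite

/-- A permutation of length `n` in the `2 × 2` gridded plane: the permutation with plot
`(i, perm i)`, the number `left` of points to the left of the vertical line, and the number `below`
of points below the horizontal line.  These numbers determine, and are determined by, the contents
of the four cells. -/
@[ext] structure GriddedPerm (n : ℕ) where
  perm : Equiv.Perm (Fin n)
  left : Fin (n + 1)
  below : Fin (n + 1)

instance (n : ℕ) : Finite (GriddedPerm n) :=
  Finite.of_injective (fun s => (s.perm, s.left, s.below)) fun s t h => by
    simp only [Prod.mk.injEq] at h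
    exact GriddedPerm.ext h.1 h.2.1 h.2.2

/-- Containment `σ ≤ π_w` of gridded permutations: some injection of the points of `σ` into the
points of `π_w` preserves the order of both coordinates and the cells. -/
def GriddedPerm.ContainedIn {n : ℕ} (s : GriddedPerm n) (w : ℕ → PinLetter) : Prop :=
  ∃ f : Fin n → ℕ, Function.Injective f ∧
    (∀ i j : Fin n, i < j ↔ (pinPoint w (f i)).1 < (pinPoint w (f j)).1) ∧
    (∀ i j : Fin n, s.perm i < s.perm j ↔ (pinPoint w (f i)).2 < (pinPoint w (f j)).2) ∧
    (∀ i : Fin n, (i : ℕ) < (s.left : ℕ) ↔ (pinPoint w (f i)).1 < 0) ∧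
    (∀ i : Fin n, (s.perm i : ℕ) < (s.below : ℕ) ↔ (pinPoint w (f i)).2 < 0)

/-- The members of length `n` of the pin class `C_w`. -/
def pinClass (w : ℕ → PinLetter) (n : ℕ) : Set (GriddedPerm n) :=
  {s | s.ContainedIn w}

/-- The pin class `C_w` has growth rate `g`: the `n`-th root of the number of its members of length
`n` converges to `g`. -/
def HasGrowthRate (w : ℕ → PinLetter) (g : ℝ) : Prop :=
  Tendsto (fun n : ℕ => ((pinClass w n).ncard : ℝ) ^ (1 / (n : ℝ))) atTop (𝓝 g)

/-- The image of a binary sequence as a pin sequence in quadrants 1 and 2: every `0` becomes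
`l_u u_l` and every `1` becomes `r_u u_r`.  Here `false` stands for `0` and `true` for `1`. -/
def pinOfBinary (b : ℕ → Bool) (i : ℕ) : PinLetter :=
  if i % 2 = 0 then (if b (i / 2) then .ru else .lu) else (if b (i / 2) then .ur else .ul)

/-- The periodic pin sequence `w_{2,2} = (lulururu)^∞`, the image of `(0011)^∞`. -/
def w22 : ℕ → PinLetter := pinOfBinary fun k => decide (2 ≤ k % 4)

/-- `w` is eventually equal to `v`: some suffix of `w` is `v`, that is, `w = u v` for a finite
word `u`. -/
def EventuallyEqual (w v : ℕ → PinLetter) : Prop :=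
  ∃ m : ℕ, ∀ i, w (m + i) = v i

/-! In quadrants 1 and 2 the pins alternate between up pins and horizontal pins, so the sequence
amounts to the types and sides of its pins. Listing a finite set of pins from the lowest to the
highest, and recording for each one its side and the lower pins that it crosses, gives a word, its
`code`. Two finite sets of pins have the same code exactly when they form the same gridded
permutation (`code_image_eq_iff`), so the members of the class are counted by codes
(`ncard_pinClass`).

Only consecutive pins can cross. Hence a set of positions splits at its gaps into runs of
consecutive positions, and the codes of these runs are concatenated. The code of a run has no proper
self-contained final segment (`indecomposable_code_run`), except when the run is an up pin followed
by a horizontal pin on the other side; that run splits into two single points. So every code is a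
product of codes of good runs, and the factorisation is unique. Codes of good runs that occur
arbitrarily far out can be concatenated in any order, and far enough out no other codes of a given
length occur. If `a_k` is the number of such codes of length `k`, the growth rate is therefore
`1/ρ`, where `∑ a_k ρ^k = 1` (`tendsto_ncard_realized`).

Recurrence of `rur` and `lul` makes all eight combinations of the type of a pin, its side and the
side two places later recur (`Mixed.frequently_start`). This gives `a_1 = 2`, `a_2 = 2`, `a_3 = 6`
and `a_k ≥ 8` for `k ≥ 4`. If the horizontal pins eventually follow the pattern left, left, right,
right, then `a_k = 8` for all `k ≥ 4`; otherwise `a_4 ≥ 9` (`nine_le_ncard_recurrentRuns_four`). The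
minimal series `2x + 2x² + 6x³ + 8x⁴/(1-x)` takes the value 1 at the reciprocal of the dominant root
of the quartic, and a larger series reaches 1 earlier, which means a larger growth rate. -/

/-! ### Upper pin sequences and codes of sets of positions -/

/-- The combinatorial data of a pin sequence in the upper half plane: which pins are up pins, and
which lie in the right half plane.  The pins alternate between up pins and horizontal pins, and an
up pin lies on the side of the horizontal pin before it. -/
structure UpperPin where
  up : ℕ → Bool
  right : ℕ → Bool
  up_succ : ∀ i, up (i + 1) = !up i
  right_succ : ∀ i, up i = false → right (i + 1) = right i

/-- A letter of the code of a pattern: the side of a point, and the rank differences to the lower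
points that it crosses. -/
abbrev CodeLetter := Bool × Set ℕ

namespace UpperPin

variable (v : UpperPin)

/-- The vertical coordinate of a pin. -/
def height (i : ℕ) : ℕ := if v.up i then 2 * i + 4 else 2 * i + 1

/-- Two pins cross if they lie on the same side and the lower one is farther out. -/
def Cross (a b : ℕ) : Prop := v.right a = v.right b ∧ (a + 1 = b ∨ b + 1 = a)

/-- Comparison of heights. -/
def Below (a b : ℕ) : Prop := v.height a ≤ v.height b

theorem height_injective : Function.Injective v.height := by
  intro a b h
  unfold height at h
  split_ifs at h <;> omega

noncomputable instance : DecidableRel v.Below := Classical.decRel _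
instance : IsTrans ℕ v.Below := ⟨fun _ _ _ h k => le_trans h k⟩
instance : Std.Antisymm v.Below := ⟨fun _ _ h k => v.height_injective (le_antisymm h k)⟩
instance : Std.Total v.Below := ⟨fun a b => le_total (v.height a) (v.height b)⟩

/-- The elements of a finite set of positions, from the lowest pin to the highest. -/
noncomputable def arrange (S : Finset ℕ) : List ℕ := S.sort v.Below

/-- The letter of the entry of rank `r` of a list of positions. -/
def letterAt (L : List ℕ) (r : ℕ) : CodeLetter :=
  (v.right (L.getD r 0), {d | 1 ≤ d ∧ d ≤ r ∧ v.Cross (L.getD (r - d) 0) (L.getD r 0)})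

/-- The code of a list of positions. -/
def listCode (L : List ℕ) : List CodeLetter := (List.range L.length).map (v.letterAt L)

/-- The code of a finite set of positions. -/
noncomputable def code (S : Finset ℕ) : List CodeLetter := v.listCode (v.arrange S)

@[simp] theorem length_listCode (L : List ℕ) : (v.listCode L).length = L.length := by
  simp [listCode]

@[simp] theorem length_arrange (S : Finset ℕ) : (v.arrange S).length = S.card := by
  simp [arrange]

@[simp] theorem length_code (S : Finset ℕ) : (v.code S).length = S.card := by
  simp [code]

@[simp] theorem mem_arrange {S : Finset ℕ} {a : ℕ} : a ∈ v.arrange S ↔ a ∈ S := by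
  simp [arrange]

theorem getElem_listCode (L : List ℕ) (r : ℕ) (h : r < (v.listCode L).length) :
    (v.listCode L)[r] = v.letterAt L r := by
  simp [listCode]

/-- A duplicate-free list that is sorted by height is the arrangement of its set of elements. -/
theorem arrange_eq {S : Finset ℕ} {L : List ℕ} (hL : L.Pairwise fun a b => v.height a < v.height b)
    (hS : ∀ a, a ∈ L ↔ a ∈ S) : v.arrange S = L := by
  have hnd : L.Nodup := hL.imp fun {a b} h => by rintro rfl; exact lt_irrefl _ h
  have hs : (v.arrange S).Pairwise v.Below := Finset.pairwise_sort S v.Below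
  have hn : (v.arrange S).Nodup := Finset.sort_nodup S v.Below
  refine List.Perm.eq_of_pairwise' (r := v.Below) hs (hL.imp fun h => le_of_lt h) ?_
  exact (List.perm_ext_iff_of_nodup hn hnd).2 fun a => by rw [hS, mem_arrange]

theorem pairwise_arrange (S : Finset ℕ) :
    (v.arrange S).Pairwise fun a b => v.height a < v.height b := by
  have hs : (v.arrange S).Pairwise v.Below := Finset.pairwise_sort S v.Below
  have hn : (v.arrange S).Nodup := Finset.sort_nodup S v.Below
  refine (hs.and hn).imp fun {a b} h => lt_of_le_of_ne h.1 fun e => h.2 (v.height_injective e)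

/-- Lists have the same code if and only if their entries lie on the same sides and cross
likewise. -/
theorem listCode_eq_iff {v v' : UpperPin} {L L' : List ℕ} :
    v.listCode L = v'.listCode L' ↔ L.length = L'.length ∧ ∀ r < L.length,
      v.right (L.getD r 0) = v'.right (L'.getD r 0) ∧
      ∀ q < r, (v.Cross (L.getD q 0) (L.getD r 0) ↔ v'.Cross (L'.getD q 0) (L'.getD r 0)) := by
  constructor
  · intro h
    have hl : L.length = L'.length := by simpa using congrArg List.length h
    refine ⟨hl, fun r hr => ?_⟩
    have e : v.letterAt L r = v'.letterAt L' r := by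
      rw [← v.getElem_listCode L r (by simpa), ← v'.getElem_listCode L' r (by simp; omega)]
      simp only [h]
    simp only [letterAt, Prod.mk.injEq] at e
    refine ⟨e.1, fun q hq => ?_⟩
    have := Set.ext_iff.1 e.2 (r - q)
    have e1 : r - (r - q) = q := by omega
    have e2 : 1 ≤ r - q := by omega
    have e3 : r - q ≤ r := by omega
    simpa [e1, e2, e3] using this
  · rintro ⟨hl, h⟩
    refine List.ext_getElem (by simp [hl]) fun r h1 h2 => ?_
    rw [getElem_listCode, getElem_listCode]
    have hr : r < L.length := by simpa using h1
    refine Prod.ext (h r hr).1 (Set.ext fun d => ?_)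
    simp only [letterAt, Set.mem_ofPred_eq]
    constructor
    · rintro ⟨a, b, c⟩
      exact ⟨a, b, ((h r hr).2 _ (by omega)).1 c⟩
    · rintro ⟨a, b, c⟩
      exact ⟨a, b, ((h r hr).2 _ (by omega)).2 c⟩

theorem listCode_append {A B : List ℕ} (h : ∀ a ∈ A, ∀ b ∈ B, ¬ v.Cross a b) :
    v.listCode (A ++ B) = v.listCode A ++ v.listCode B := by
  refine List.ext_getElem (by simp) fun r h1 h2 => ?_
  rw [getElem_listCode]
  have hr : r < A.length + B.length := by simpa using h1
  by_cases hA : r < A.length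
  · rw [List.getElem_append_left (by simpa), getElem_listCode]
    refine Prod.ext (by simp only [letterAt, List.getD_append _ _ _ _ hA]) (Set.ext fun d => ?_)
    simp only [letterAt, Set.mem_ofPred_eq]
    rw [List.getD_append _ _ _ _ hA, List.getD_append _ _ _ (r - d) (by omega)]
  · rw [List.getElem_append_right (by simp; omega), getElem_listCode, length_listCode]
    push Not at hA
    have e0 := List.getD_append_right A B 0 r hA
    refine Prod.ext (by simp only [letterAt, e0]) (Set.ext fun d => ?_)
    simp only [letterAt, Set.mem_ofPred_eq, e0]
    have hB : B.getD (r - A.length) 0 ∈ B := by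
      rw [List.getD_eq_getElem _ _ (by omega)]; exact List.getElem_mem _
    constructor
    · rintro ⟨a, b, c⟩
      by_cases hd : d ≤ r - A.length
      · rw [List.getD_append_right A B 0 _ (by omega)] at c
        refine ⟨a, hd, ?_⟩
        rwa [show r - A.length - d = r - d - A.length by omega]
      · exfalso
        rw [List.getD_append _ _ _ _ (by omega), List.getD_eq_getElem _ _ (by omega)] at c
        exact h _ (List.getElem_mem _) _ hB c
    · rintro ⟨a, b, c⟩
      refine ⟨a, by omega, ?_⟩
      rw [List.getD_append_right A B 0 _ (by omega)]
      rwa [show r - d - A.length = r - A.length - d by omega]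

/-- If all of `A` lies below `B` and nothing crosses, the code of the union is a concatenation. -/
theorem code_union_of_below {A B : Finset ℕ} (h : ∀ a ∈ A, ∀ b ∈ B, v.height a < v.height b)
    (hc : ∀ a ∈ A, ∀ b ∈ B, ¬ v.Cross a b) : v.code (A ∪ B) = v.code A ++ v.code B := by
  have : v.arrange (A ∪ B) = v.arrange A ++ v.arrange B := by
    refine v.arrange_eq ?_ (by simp)
    rw [List.pairwise_append]
    exact ⟨v.pairwise_arrange A, v.pairwise_arrange B, by simpa using h⟩
  rw [code, this, v.listCode_append (by simpa using hc)]
  rfl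

theorem height_le (i : ℕ) : v.height i ≤ 2 * i + 4 := by unfold height; split_ifs <;> omega
theorem le_height (i : ℕ) : 2 * i + 1 ≤ v.height i := by unfold height; split_ifs <;> omega

/-- Sets of positions that are separated by a gap contribute separately to the code. -/
theorem code_union {A B : Finset ℕ} (h : ∀ a ∈ A, ∀ b ∈ B, a + 2 ≤ b) :
    v.code (A ∪ B) = v.code A ++ v.code B := by
  refine v.code_union_of_below (fun a ha b hb => ?_) fun a ha b hb hc => ?_
  · have := v.height_le a
    have := v.le_height b
    have := h a ha b hb
    omega
  · have := h a ha b hb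
    rcases hc.2 with e | e <;> omega

@[simp] theorem code_empty : v.code ∅ = [] := by
  rw [← List.length_eq_zero_iff]; simp

end UpperPin

/-! ### Indecomposable codes and unique decoding -/

/-- A code in which no letter refers to anything before the beginning. -/
def SelfContained (l : List CodeLetter) : Prop :=
  ∀ (r : ℕ) (h : r < l.length), ∀ d ∈ l[r].2, d ≤ r

/-- A code that has no proper self-contained final segment. -/
def Indecomposable (c : List CodeLetter) : Prop :=
  ∀ k, 0 < k → k < c.length → ¬ SelfContained (c.drop k)

theorem SelfContained.of_append {a b : List CodeLetter} (h : SelfContained (a ++ b)) :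
    SelfContained a := by
  intro r hr d hd
  refine h r (by simp; omega) d ?_
  rwa [List.getElem_append_left hr]

/-- Unique decoding: an indecomposable first factor is determined by the product. -/
theorem append_left_cancel_of_indecomposable {s t a b : List CodeLetter} (hs0 : s ≠ [])
    (ht0 : t ≠ []) (hs : Indecomposable s) (ht : Indecomposable t) (ha : SelfContained a)
    (hb : SelfContained b) (h : s ++ a = t ++ b) : s = t ∧ a = b := by
  have key : ∀ {s t a b : List CodeLetter}, s ≠ [] → Indecomposable t → SelfContained a →
      s ++ a = t ++ b → t.length ≤ s.length := by
    intro s t a b hs0 ht ha h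
    by_contra hlt
    push Not at hlt
    -- If `s` were shorter than `t`, the rest of `t` would be an initial segment of the
    -- self-contained code `a`, hence a self-contained final segment of `t`.
    refine ht s.length (List.length_pos_iff.2 hs0) hlt ?_
    have := congrArg (List.drop s.length) h
    rw [List.drop_left, List.drop_append_of_le_length hlt.le] at this
    rw [this] at ha
    exact ha.of_append
  have hl : s.length = t.length :=
    le_antisymm (key ht0 hs hb h.symm) (key hs0 ht ha h)
  exact List.append_inj h hl

namespace UpperPin

variable (v : UpperPin)

theorem selfContained_listCode (L : List ℕ) : SelfContained (v.listCode L) := by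
  intro r hr d hd
  rw [getElem_listCode] at hd
  exact hd.2.1

theorem selfContained_code (S : Finset ℕ) : SelfContained (v.code S) :=
  v.selfContained_listCode _

/-- Crossings are recorded at the higher point, so a self-contained final segment marks a height at
which the set can be cut without separating two crossing points. -/
theorem selfContained_drop_code {S : Finset ℕ} {k : ℕ}
    (h : SelfContained ((v.code S).drop k)) :
    ∀ a ∈ (v.arrange S).take k, ∀ b ∈ (v.arrange S).drop k, ¬ v.Cross a b := by
  intro a ha b hb hc
  obtain ⟨q, hq, rfl⟩ := List.mem_iff_getElem.1 ha
  obtain ⟨r, hr, rfl⟩ := List.mem_iff_getElem.1 hb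
  simp only [List.length_take, List.length_drop] at hq hr
  simp only [List.getElem_take, List.getElem_drop] at hc
  have hlen : k + r < (v.arrange S).length := by omega
  have := h r (by simp at hr ⊢; omega) (k + r - q) ?_
  · omega
  · rw [List.getElem_drop]
    unfold code
    rw [getElem_listCode]
    refine ⟨by omega, by omega, ?_⟩
    rw [show k + r - (k + r - q) = q by omega, List.getD_eq_getElem _ _ (by omega),
      List.getD_eq_getElem _ _ hlen]
    exact hc

/-- The run of `k` consecutive positions from `i`. -/
def run (i k : ℕ) : Finset ℕ := Finset.Ico i (i + k)

/-- The only runs with a decomposable code are those that consist of an up pin and a horizontal pin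
on the other side. -/
def Good (i k : ℕ) : Prop := 0 < k ∧ ¬ (k = 2 ∧ v.up i = true ∧ v.right i ≠ v.right (i + 1))

theorem height_succ_lt (i : ℕ) (h : v.up i = true) : v.height (i + 1) < v.height i := by
  simp [height, h, v.up_succ]; omega

theorem lt_height_of_le {i j : ℕ} (h : i + 2 ≤ j) : v.height i < v.height j := by
  have := v.height_le i
  have := v.le_height j
  omega

theorem cross_succ {i : ℕ} (h : v.up i = false) : v.Cross i (i + 1) :=
  ⟨(v.right_succ i h).symm, Or.inl rfl⟩

theorem Cross.symm {v : UpperPin} {a b : ℕ} (h : v.Cross a b) : v.Cross b a :=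
  ⟨h.1.symm, h.2.symm⟩

/-- Suppose that the run is cut into a lower part `A` and an upper part `B` without crossings
between them. Then `A` is closed under crossing and under passing to lower pins. Neighbouring
positions are linked by these two rules, so one element of `A` drags the whole run into `A`. -/
theorem indecomposable_code_run {i k : ℕ} (hg : v.Good i k) :
    Indecomposable (v.code (run i k)) := by
  intro m hm0 hm hsc
  have hcard : (run i k).card = k := by simp [run]
  rw [length_code, hcard] at hm
  have hcr := v.selfContained_drop_code hsc
  have hlt : ∀ a ∈ (v.arrange (run i k)).take m, ∀ b ∈ (v.arrange (run i k)).drop m,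
      v.height a < v.height b := by
    have := v.pairwise_arrange (run i k)
    rw [← List.take_append_drop m (v.arrange (run i k)), List.pairwise_append] at this
    exact this.2.2
  have hmem : ∀ a, a ∈ run i k ↔
      a ∈ (v.arrange (run i k)).take m ∨ a ∈ (v.arrange (run i k)).drop m := by
    intro a
    rw [← List.mem_append, List.take_append_drop, mem_arrange]
  have hR : ∀ a, a ∈ run i k ↔ i ≤ a ∧ a < i + k := by simp [run]
  set A := (v.arrange (run i k)).take m with hA
  set B := (v.arrange (run i k)).drop m with hB
  -- membership in `A` propagates along crossings and downwards
  have hcross : ∀ a b, a ∈ A → b ∈ run i k → v.Cross a b → b ∈ A := by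
    intro a b ha hb h
    exact ((hmem b).1 hb).resolve_right fun h' => hcr a ha b h' h
  have hlow : ∀ a b, a ∈ A → b ∈ run i k → v.height b < v.height a → b ∈ A := by
    intro a b ha hb h
    exact ((hmem b).1 hb).resolve_right fun h' => absurd (hlt a ha b h') (by omega)
  have hup : ∀ p, p ∈ A → p + 1 < i + k → p + 1 ∈ A := by
    intro p hp hpk
    have hpR := (hR p).1 ((hmem p).2 (Or.inl hp))
    have h1 : p + 1 ∈ run i k := (hR _).2 ⟨by omega, hpk⟩
    cases hu : v.up p
    · exact hcross p _ hp h1 (v.cross_succ hu)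
    · exact hlow p _ hp h1 (v.height_succ_lt p hu)
  have hdown : ∀ p, i ≤ p → p + 1 ∈ A → p ∈ A := by
    intro p hp hpA
    have hpR := (hR _).1 ((hmem _).2 (Or.inl hpA))
    have h1 : p ∈ run i k := (hR _).2 ⟨hp, by omega⟩
    cases hu : v.up p with
    | false => exact hcross (p + 1) _ hpA h1 (v.cross_succ hu).symm
    | true =>
      -- For an up pin `p` the position `p + 1` is lower, so `p` has to be reached differently: from
      -- the higher pin `p + 2` if it is in the run, else by its crossing with `p - 1`, which lies
      -- below `p + 1`. If neither position is in the run, then `k = 2`, and goodness makes `p` and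
      -- `p + 1` cross.
      by_cases h2 : p + 2 < i + k
      · have h3 := hup (p + 1) hpA h2
        exact hlow _ p h3 h1 (v.lt_height_of_le le_rfl)
      · by_cases h3 : i < p
        · obtain ⟨q, rfl⟩ : ∃ q, p = q + 1 := ⟨p - 1, by omega⟩
          have hq : v.up q = false := by
            have := v.up_succ q
            rw [hu] at this
            simpa using this.symm
          have hqA : q ∈ A := hlow (q + 1 + 1) q hpA ((hR _).2 ⟨by omega, by omega⟩)
            (v.lt_height_of_le le_rfl)
          exact hcross q _ hqA h1 (v.cross_succ hq)
        · obtain rfl : p = i := by omega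
          have hk : k = 2 := by omega
          have : v.right p = v.right (p + 1) := by
            by_contra hne
            exact hg.2 ⟨hk, hu, hne⟩
          exact hcross (p + 1) _ hpA h1 ⟨this.symm, Or.inr rfl⟩
  have hlenA : 0 < A.length := by simp [hA, hcard]; omega
  have hlenB : 0 < B.length := by simp [hB, hcard]; omega
  obtain ⟨a, ha⟩ := List.exists_mem_of_length_pos hlenA
  obtain ⟨b, hb⟩ := List.exists_mem_of_length_pos hlenB
  have hall_down : ∀ n p, p + n = a → i ≤ p → p ∈ A := by
    intro n
    induction n with
    | zero => rintro p rfl _; exact ha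
    | succ n ih => intro p hp hi; exact hdown p hi (ih (p + 1) (by omega) (by omega))
  have hall_up : ∀ n, a + n < i + k → a + n ∈ A := by
    intro n
    induction n with
    | zero => intro _; exact ha
    | succ n ih => intro hn; exact hup (a + n) (ih (by omega)) hn
  have hbR := (hR b).1 ((hmem b).2 (Or.inr hb))
  have hbA : b ∈ A := by
    rcases le_total a b with h | h
    · obtain ⟨n, rfl⟩ := Nat.exists_eq_add_of_le h
      exact hall_up n hbR.2
    · obtain ⟨n, rfl⟩ := Nat.exists_eq_add_of_le h
      exact hall_down n b rfl hbR.1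
  exact lt_irrefl _ (hlt b hbA b hb)

end UpperPin

/-! ### Counting products of sets of lists -/

/-- A family of products of sets of lists has at most the expected size. -/
theorem finite_and_ncard_le_sum_of_subset_append {α : Type*} {n : ℕ} {R : Set (List α)}
    {A B : ℕ → Set (List α)} (hA : ∀ k < n, (A k).Finite) (hB : ∀ k < n, (B k).Finite)
    (hR : ∀ c ∈ R, ∃ k < n, ∃ a ∈ A k, ∃ b ∈ B k, c = a ++ b) :
    R.Finite ∧ R.ncard ≤ ∑ k ∈ Finset.range n, (A k).ncard * (B k).ncard := by
  classical
  let U : Finset (List α) := (Finset.range n).attach.biUnion fun k =>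
    Finset.image₂ (· ++ ·) (hA k (Finset.mem_range.1 k.2)).toFinset
      (hB k (Finset.mem_range.1 k.2)).toFinset
  have hsub : R ⊆ U := by
    intro c hc
    obtain ⟨k, hk, a, ha, b, hb, rfl⟩ := hR c hc
    refine Finset.mem_coe.2 (Finset.mem_biUnion.2 ⟨⟨k, Finset.mem_range.2 hk⟩, by simp, ?_⟩)
    exact Finset.mem_image₂_of_mem (by simpa using ha) (by simpa using hb)
  refine ⟨(Finset.finite_toSet _).subset hsub, ?_⟩
  calc R.ncard ≤ (U : Set (List α)).ncard := Set.ncard_le_ncard hsub (Finset.finite_toSet _)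
    _ = U.card := Set.ncard_coe_finset _
    _ ≤ ∑ k ∈ (Finset.range n).attach, (A k).ncard * (B k).ncard := by
        refine Finset.card_biUnion_le.trans (Finset.sum_le_sum fun k _ => ?_)
        have hk := Finset.mem_range.1 k.2
        rw [Set.ncard_eq_toFinset_card _ (hA k hk), Set.ncard_eq_toFinset_card _ (hB k hk)]
        exact Finset.card_image₂_le _ _ _
    _ = _ := Finset.sum_attach _ fun k => (A k).ncard * (B k).ncard

/-- A uniquely decodable family of products of sets of lists has at least the expected size. -/
theorem sum_le_ncard_of_append_mem {α : Type*} {n : ℕ} {R : Set (List α)} (hRf : R.Finite)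
    {A B : ℕ → Set (List α)} (hR : ∀ k < n, ∀ a ∈ A k, ∀ b ∈ B k, a ++ b ∈ R)
    (hinj : ∀ k < n, ∀ l < n, ∀ a ∈ A k, ∀ b ∈ B k, ∀ a' ∈ A l, ∀ b' ∈ B l,
      a ++ b = a' ++ b' → k = l ∧ a = a' ∧ b = b')
    (hA : ∀ k < n, (A k).Finite) (hB : ∀ k < n, (B k).Finite) :
    ∑ k ∈ Finset.range n, (A k).ncard * (B k).ncard ≤ R.ncard := by
  classical
  let P : ℕ → Finset (List α × List α) := fun k =>
    if h : k < n then (hA k h).toFinset ×ˢ (hB k h).toFinset else ∅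
  have hP : ∀ k < n, (P k).card = (A k).ncard * (B k).ncard := fun k hk => by
    simp only [P, hk, dif_pos]
    rw [Finset.card_product, Set.ncard_eq_toFinset_card _ (hA k hk),
      Set.ncard_eq_toFinset_card _ (hB k hk)]
  have hPm : ∀ k < n, ∀ p, p ∈ P k ↔ p.1 ∈ A k ∧ p.2 ∈ B k := fun k hk p => by
    simp [P, hk]
  calc ∑ k ∈ Finset.range n, (A k).ncard * (B k).ncard
      = ∑ k ∈ Finset.range n, (P k).card :=
        Finset.sum_congr rfl fun k hk => (hP k (Finset.mem_range.1 hk)).symm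
    _ = ((Finset.range n).sigma P).card := (Finset.card_sigma _ _).symm
    _ ≤ hRf.toFinset.card := by
        refine Finset.card_le_card_of_injOn (fun p => p.2.1 ++ p.2.2) ?_ ?_
        · rintro ⟨k, p⟩ hp
          simp only [Finset.mem_coe, Finset.mem_sigma, Finset.mem_range] at hp
          have := (hPm k hp.1 p).1 hp.2
          simpa using hR k hp.1 _ this.1 _ this.2
        · rintro ⟨k, a, b⟩ hp ⟨l, a', b'⟩ hq h
          simp only [Finset.mem_coe, Finset.mem_sigma, Finset.mem_range] at hp hq
          have h1 := (hPm k hp.1 _).1 hp.2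
          have h2 := (hPm l hq.1 _).1 hq.2
          obtain ⟨rfl, rfl, rfl⟩ := hinj k hp.1 l hq.1 a h1.1 b h1.2 a' h2.1 b' h2.2 h
          rfl
    _ = R.ncard := (Set.ncard_eq_toFinset_card _ hRf).symm

/-! ### Codes of runs and recursive bounds for the number of codes -/

namespace UpperPin

variable (v : UpperPin)

/-- The offset of the entry of rank `r` in a run of length `k`; `u` tells if the run starts with
an up pin. -/
def offset (u : Bool) (k r : ℕ) : ℕ :=
  if decide (r % 2 = 0) = u then (if r + 1 < k then r + 1 else r) else r - 1

theorem up_add (i j : ℕ) : v.up (i + j) = if j % 2 = 0 then v.up i else !v.up i := by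
  induction j with
  | zero => simp
  | succ j ih =>
    rw [← add_assoc, v.up_succ, ih]
    rcases Nat.mod_two_eq_zero_or_one j with h | h <;>
      simp [h, Nat.add_mod]

theorem height_add (i j : ℕ) : v.height (i + j) =
    if (v.up i = true ↔ j % 2 = 0) then 2 * (i + j) + 4 else 2 * (i + j) + 1 := by
  unfold height
  rw [up_add]
  by_cases hj : j % 2 = 0 <;> cases v.up i <;> simp [hj]

/-- The order by height is the order of positions, except that each up pin changes places with the
horizontal pin after it. A first horizontal pin or a last up pin of the run has no partner and stays
in place. -/
theorem arrange_run (i k : ℕ) :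
    v.arrange (run i k) = (List.range k).map fun r => i + offset (v.up i) k r := by
  refine v.arrange_eq ?_ fun a => ?_
  · rw [List.pairwise_map]
    refine List.Pairwise.imp_of_mem (R := (· < ·)) ?_ List.pairwise_lt_range
    intro r s hr hs hrs
    rw [List.mem_range] at hr hs
    rw [height_add, height_add]
    rcases Nat.mod_two_eq_zero_or_one r with h | h <;>
    rcases Nat.mod_two_eq_zero_or_one s with h' | h' <;>
    cases v.up i <;> simp only [offset, h, h'] <;> simp <;> split_ifs <;> omega
  · simp only [List.mem_map, List.mem_range, run, Finset.mem_Ico]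
    constructor
    · rintro ⟨r, hr, rfl⟩
      unfold offset
      split_ifs <;> omega
    · rintro ⟨h1, h2⟩
      obtain ⟨j, rfl⟩ := Nat.exists_eq_add_of_le h1
      have hj : j < k := by omega
      rcases Nat.mod_two_eq_zero_or_one j with h | h <;> cases v.up i
      · refine ⟨j - 1, by omega, ?_⟩
        rcases Nat.eq_zero_or_pos j with rfl | h0
        · simp [offset]
        · have : (j - 1) % 2 = 1 := by omega
          simp [offset, this]; split_ifs <;> omega
      · by_cases hk : j + 1 < k
        · refine ⟨j + 1, hk, ?_⟩
          have : (j + 1) % 2 = 1 := by omega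
          simp [offset, this]
        · refine ⟨j, hj, ?_⟩
          simp [offset, h, hk]
      · by_cases hk : j + 1 < k
        · refine ⟨j + 1, hk, ?_⟩
          have : (j + 1) % 2 = 0 := by omega
          simp [offset, this]
        · refine ⟨j, hj, ?_⟩
          simp [offset, h, hk]
      · refine ⟨j - 1, by omega, ?_⟩
        have : (j - 1) % 2 = 0 := by omega
        simp [offset, this]; split_ifs <;> omega

theorem offset_lt {u : Bool} {k r : ℕ} (h : r < k) : offset u k r < k := by
  unfold offset; split_ifs <;> omega

theorem cross_add_iff {v v' : UpperPin} {i i' k a b : ℕ} (ha : a < k) (hb : b < k)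
    (h : ∀ j < k, v.right (i + j) = v'.right (i' + j)) :
    v.Cross (i + a) (i + b) ↔ v'.Cross (i' + a) (i' + b) := by
  unfold Cross
  rw [h a ha, h b hb]
  refine and_congr_right fun _ => ?_
  omega

theorem getD_arrange_run {i k r : ℕ} (h : r < k) :
    (v.arrange (run i k)).getD r 0 = i + offset (v.up i) k r := by
  rw [arrange_run, List.getD_eq_getElem _ _ (by simpa)]
  simp

@[simp] theorem card_run (i k : ℕ) : (run i k).card = k := by simp [run]

/-- The code of a run depends only on its word. -/
theorem code_run_congr {v v' : UpperPin} {i i' k : ℕ} (hu : v.up i = v'.up i')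
    (h : ∀ j < k, v.right (i + j) = v'.right (i' + j)) :
    v.code (run i k) = v'.code (run i' k) := by
  refine listCode_eq_iff.2 ⟨by simp, fun r hr => ?_⟩
  have hr' : r < k := by simpa using hr
  rw [getD_arrange_run v hr', getD_arrange_run v' hr', ← hu]
  refine ⟨h _ (offset_lt hr'), fun q hq => ?_⟩
  rw [getD_arrange_run v (hq.trans hr'), getD_arrange_run v' (hq.trans hr'), ← hu]
  exact cross_add_iff (offset_lt (hq.trans hr')) (offset_lt hr') h

/-- The codes of sets of `n` positions from `m` on. -/
def realized (m n : ℕ) : Set (List CodeLetter) :=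
  {c | ∃ S : Finset ℕ, (∀ a ∈ S, m ≤ a) ∧ S.card = n ∧ v.code S = c}

/-- The codes of sets of `n` positions that occur arbitrarily far out. -/
def recurrent (n : ℕ) : Set (List CodeLetter) := {c | ∀ m, c ∈ v.realized m n}

/-- The codes of good runs of length `k` from `m` on. -/
def runCodes (m k : ℕ) : Set (List CodeLetter) :=
  {c | ∃ i, m ≤ i ∧ v.Good i k ∧ v.code (run i k) = c}

/-- The codes of good runs of length `k` that occur arbitrarily far out. -/
def recurrentRuns (k : ℕ) : Set (List CodeLetter) := {c | ∀ m, c ∈ v.runCodes m k}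

/-- The word of the run of length `k` from `i`. -/
def word (i k : ℕ) : Bool × (Fin k → Bool) := (v.up i, fun j => v.right (i + j))

theorem code_run_eq_of_word_eq {v v' : UpperPin} {i i' k : ℕ} (h : v.word i k = v'.word i' k) :
    v.code (run i k) = v'.code (run i' k) := by
  simp only [word, Prod.mk.injEq] at h
  exact code_run_congr h.1 fun j hj => congrFun h.2 ⟨j, hj⟩

theorem finite_and_ncard_runCodes_le (m k : ℕ) :
    (v.runCodes m k).Finite ∧ (v.runCodes m k).ncard ≤ 2 ^ (k + 1) := by
  classical
  -- The code of a run depends only on its word, and there are `2 ^ (k + 1)` words; `f` evaluates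
  -- the code at some occurrence of the word.
  let f : Bool × (Fin k → Bool) → List CodeLetter := fun x =>
    if h : ∃ i, v.word i k = x then v.code (run h.choose k) else []
  have hsub : v.runCodes m k ⊆ f '' Set.univ := by
    rintro c ⟨i, _, _, rfl⟩
    refine ⟨v.word i k, trivial, ?_⟩
    have h : ∃ j, v.word j k = v.word i k := ⟨i, rfl⟩
    simp only [f, h, dif_pos]
    exact code_run_eq_of_word_eq h.choose_spec
  refine ⟨(Set.toFinite _).subset hsub, (Set.ncard_le_ncard hsub (Set.toFinite _)).trans ?_⟩
  refine (Set.ncard_image_le (Set.toFinite _)).trans ?_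
  rw [Set.ncard_univ, Nat.card_eq_fintype_card]
  simp [pow_succ, mul_comm]

theorem finite_runCodes (m k : ℕ) : (v.runCodes m k).Finite :=
  (v.finite_and_ncard_runCodes_le m k).1

theorem recurrentRuns_subset (m k : ℕ) : v.recurrentRuns k ⊆ v.runCodes m k := fun _ h => h m

theorem finite_recurrentRuns (k : ℕ) : (v.recurrentRuns k).Finite :=
  (v.finite_runCodes 0 k).subset (v.recurrentRuns_subset 0 k)

theorem ncard_recurrentRuns_le (k : ℕ) : (v.recurrentRuns k).ncard ≤ 2 ^ (k + 1) :=
  (Set.ncard_le_ncard (v.recurrentRuns_subset 0 k) (v.finite_runCodes 0 k)).trans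
    (v.finite_and_ncard_runCodes_le 0 k).2

theorem runCodes_anti {m m' : ℕ} (h : m ≤ m') (k : ℕ) : v.runCodes m' k ⊆ v.runCodes m k := by
  rintro c ⟨i, hi, hc⟩
  exact ⟨i, h.trans hi, hc⟩

/-- Far enough out, all codes of runs of a given length are recurrent. -/
theorem eventually_runCodes_eq (k : ℕ) :
    ∀ᶠ m in atTop, v.runCodes m k = v.recurrentRuns k := by
  have hf : ∀ c ∈ v.runCodes 0 k \ v.recurrentRuns k, ∀ᶠ m in atTop, c ∉ v.runCodes m k := by
    rintro c ⟨-, hc⟩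
    simp only [recurrentRuns, Set.mem_ofPred_eq, not_forall] at hc
    obtain ⟨m, hm⟩ := hc
    filter_upwards [eventually_ge_atTop m] with m' hm' h
    exact hm (v.runCodes_anti hm' k h)
  have := (((v.finite_runCodes 0 k).subset Set.sdiff_subset).eventually_all).2 hf
  filter_upwards [this] with m hm
  refine Set.Subset.antisymm (fun c hc => ?_) (v.recurrentRuns_subset m k)
  by_contra h
  exact hm c ⟨v.runCodes_anti (Nat.zero_le m) k hc, h⟩ hc

/-- A nonempty finite set of positions starts with a maximal run. -/
theorem exists_run_union {S : Finset ℕ} {i : ℕ} (hi : i ∈ S) (hmin : ∀ a ∈ S, i ≤ a) :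
    ∃ (k : ℕ) (T : Finset ℕ), S = run i (k + 1) ∪ T ∧ ∀ a ∈ T, i + (k + 1) + 1 ≤ a := by
  classical
  have hex : ∃ k, i + (k + 1) ∉ S := by
    obtain ⟨b, hb⟩ := S.bddAbove
    exact ⟨b, fun h => absurd (hb h) (by omega)⟩
  refine ⟨Nat.find hex, S.filter (i + (Nat.find hex + 1) < ·), ?_, by simp⟩
  have hlt : ∀ j < Nat.find hex, i + (j + 1) ∈ S := fun j hj => by
    simpa using Nat.find_min hex hj
  have hsp := Nat.find_spec hex
  ext a
  simp only [run, Finset.mem_union, Finset.mem_Ico, Finset.mem_filter]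
  constructor
  · intro ha
    by_cases h : a < i + (Nat.find hex + 1)
    · exact Or.inl ⟨hmin a ha, h⟩
    · refine Or.inr ⟨ha, lt_of_le_of_ne (by omega) ?_⟩
      rintro rfl
      exact hsp ha
  · rintro (⟨h1, h2⟩ | h)
    · rcases h1.eq_or_lt with rfl | h1
      · exact hi
      · have := hlt (a - i - 1) (by omega)
        rwa [show i + (a - i - 1 + 1) = a by omega] at this
    · exact h.1

theorem card_run_union {i k : ℕ} {T : Finset ℕ} (h : ∀ a ∈ T, i + k + 1 ≤ a) :
    (run i k ∪ T).card = k + T.card := by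
  rw [Finset.card_union_of_disjoint, card_run]
  rw [Finset.disjoint_left]
  intro a ha hT
  have := h a hT
  simp [run] at ha
  omega

theorem code_run_union {i k : ℕ} {T : Finset ℕ} (h : ∀ a ∈ T, i + k + 1 ≤ a) :
    v.code (run i k ∪ T) = v.code (run i k) ++ v.code T := by
  refine v.code_union fun a ha b hb => ?_
  have := h b hb
  simp [run] at ha
  omega

/-- Every code of `n + 1` positions from `m` on starts with the code of a good run. -/
theorem exists_append_of_mem_realized {m n : ℕ} {c : List CodeLetter}
    (hc : c ∈ v.realized m (n + 1)) :
    ∃ k < n + 1, ∃ a ∈ v.runCodes m (k + 1), ∃ b ∈ v.realized m (n - k), c = a ++ b := by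
  obtain ⟨S, hS, hcard, rfl⟩ := hc
  have hne : S.Nonempty := Finset.card_pos.1 (by omega)
  obtain ⟨i, hi, hmin⟩ := S.exists_min_image id hne
  obtain ⟨k, T, rfl, hT⟩ := exists_run_union hi hmin
  have hmi : m ≤ i := hS i hi
  rw [card_run_union hT] at hcard
  by_cases hg : v.Good i (k + 1)
  · exact ⟨k, by omega, _, ⟨i, hmi, hg, rfl⟩, _, ⟨T, fun a ha => by have := hT a ha; omega,
      by omega, rfl⟩, v.code_run_union hT⟩
  -- In a bad run `i, i + 1` the horizontal pin `i + 1` is the lowest point of the set and crosses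
  -- nothing. It is split off as a good run of length 1, and `i` joins the remaining positions.
  · simp only [Good, Nat.succ_pos, true_and, not_not] at hg
    obtain ⟨hk, hu, hne'⟩ := hg
    obtain rfl : k = 1 := by omega
    have hnot : i ∉ T := fun h => by have := hT i h; omega
    refine ⟨0, by omega, _, ⟨i + 1, by omega, ⟨by omega, by omega⟩, rfl⟩, _,
      ⟨insert i T, ?_, ?_, rfl⟩, ?_⟩
    · intro a ha
      rcases Finset.mem_insert.1 ha with rfl | ha
      · exact hmi
      · have := hT a ha; omega
    · rw [Finset.card_insert_of_notMem hnot]; omega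
    · rw [show run i (1 + 1) ∪ T = run (i + 1) (0 + 1) ∪ insert i T by
        ext a
        have : (i ≤ a ∧ a < i + (1 + 1)) ↔ (i + 1 ≤ a ∧ a < i + 1 + (0 + 1)) ∨ a = i := by omega
        simp only [run, Finset.mem_union, Finset.mem_insert, Finset.mem_Ico]
        tauto]
      refine v.code_union_of_below ?_ ?_
      · intro a ha b hb
        obtain rfl : a = i + 1 := by simp [run] at ha; omega
        rcases Finset.mem_insert.1 hb with rfl | hb
        · exact v.height_succ_lt _ hu
        · exact v.lt_height_of_le (by have := hT b hb; omega)
      · intro a ha b hb hx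
        obtain rfl : a = i + 1 := by simp [run] at ha; omega
        rcases Finset.mem_insert.1 hb with rfl | hb
        · exact hne' hx.1.symm
        · have := hT b hb
          rcases hx.2 with h | h <;> omega

theorem realized_zero (m : ℕ) : v.realized m 0 = {[]} := by
  ext c
  simp only [realized, Finset.card_eq_zero, Set.mem_ofPred_eq, Set.mem_singleton_iff]
  constructor
  · rintro ⟨S, -, rfl, rfl⟩; simp
  · rintro rfl; exact ⟨∅, by simp, rfl, by simp⟩

theorem finite_realized (m n : ℕ) : (v.realized m n).Finite := by
  induction n using Nat.strong_induction_on with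
  | _ n ih =>
    cases n with
    | zero => rw [realized_zero]; exact Set.finite_singleton _
    | succ n =>
      exact (finite_and_ncard_le_sum_of_subset_append (A := fun k => v.runCodes m (k + 1))
        (B := fun k => v.realized m (n - k)) (fun k _ => v.finite_runCodes _ _)
        (fun k _ => ih _ (by omega)) fun c hc => v.exists_append_of_mem_realized hc).1

theorem ncard_realized_succ_le (m n : ℕ) : (v.realized m (n + 1)).ncard ≤
    ∑ k ∈ Finset.range (n + 1), (v.runCodes m (k + 1)).ncard * (v.realized m (n - k)).ncard :=
  (finite_and_ncard_le_sum_of_subset_append (A := fun k => v.runCodes m (k + 1))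
    (B := fun k => v.realized m (n - k)) (fun _ _ => v.finite_runCodes _ _)
    (fun _ _ => v.finite_realized _ _) fun _ hc => v.exists_append_of_mem_realized hc).2

/-- Removing the first position changes the number of codes by a bounded factor only. -/
theorem ncard_realized_le_sum (m n : ℕ) : (v.realized m n).ncard ≤
    ∑ k ∈ Finset.range (n + 1), (v.realized (m + 1) (n - k)).ncard := by
  have := (finite_and_ncard_le_sum_of_subset_append (R := v.realized m n) (n := n + 1)
    (A := fun k => {v.code (run m k)})
    (B := fun k => v.realized (m + 1) (n - k)) (fun k _ => Set.finite_singleton _)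
    (fun k _ => v.finite_realized _ _) ?_).2
  · simpa using this
  rintro c ⟨S, hS, hcard, rfl⟩
  by_cases hm : m ∈ S
  · obtain ⟨k, T, rfl, hT⟩ := exists_run_union hm hS
    rw [card_run_union hT] at hcard
    exact ⟨k + 1, by omega, _, rfl, _, ⟨T, fun a ha => by have := hT a ha; omega, by omega, rfl⟩,
      v.code_run_union hT⟩
  · refine ⟨0, by omega, _, rfl, _, ⟨S, fun a ha => ?_, by simpa using hcard, rfl⟩, by simp [run]⟩
    exact lt_of_le_of_ne (hS a ha) (by rintro rfl; exact hm ha)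

/-- The second factor can be realized beyond the end of any chosen occurrence of the first, with a
gap between them. This is why recurrent codes, unlike merely realized ones, multiply freely. -/
theorem append_mem_recurrent {k n : ℕ} {a b : List CodeLetter} (ha : a ∈ v.recurrentRuns k)
    (hb : b ∈ v.recurrent n) : a ++ b ∈ v.recurrent (k + n) := by
  intro m
  obtain ⟨i, hi, hg, rfl⟩ := ha m
  obtain ⟨T, hT, rfl, rfl⟩ := hb (i + k + 1)
  refine ⟨run i k ∪ T, fun a ha => ?_, card_run_union hT, v.code_run_union hT⟩
  rcases Finset.mem_union.1 ha with h | h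
  · simp [run] at h; omega
  · have := hT a h; omega

theorem finite_recurrent (n : ℕ) : (v.recurrent n).Finite :=
  (v.finite_realized 0 n).subset fun _ h => h 0

theorem sum_le_ncard_recurrent_succ (n : ℕ) :
    ∑ k ∈ Finset.range (n + 1), (v.recurrentRuns (k + 1)).ncard * (v.recurrent (n - k)).ncard ≤
      (v.recurrent (n + 1)).ncard := by
  have hsc : ∀ {n b}, b ∈ v.recurrent n → SelfContained b := fun hb => by
    obtain ⟨S, -, -, rfl⟩ := hb 0
    exact v.selfContained_code S
  have hrun : ∀ {k a}, a ∈ v.recurrentRuns k → a.length = k ∧ a ≠ [] ∧ Indecomposable a := by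
    intro k a ha
    obtain ⟨i, -, hg, rfl⟩ := ha 0
    refine ⟨by simp, fun h => ?_, v.indecomposable_code_run hg⟩
    have := congrArg List.length h
    have := hg.1
    simp at *
    omega
  refine sum_le_ncard_of_append_mem (A := fun k => v.recurrentRuns (k + 1))
    (B := fun k => v.recurrent (n - k)) (v.finite_recurrent _) ?_ ?_
    (fun k _ => v.finite_recurrentRuns _) fun k _ => v.finite_recurrent _
  · intro k hk a ha b hb
    have := v.append_mem_recurrent ha hb
    rwa [show k + 1 + (n - k) = n + 1 by omega] at this
  · intro k _ l _ a ha b hb a' ha' b' hb' h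
    obtain ⟨l1, n1, i1⟩ := hrun ha
    obtain ⟨l2, n2, i2⟩ := hrun ha'
    obtain ⟨rfl, rfl⟩ :=
      append_left_cancel_of_indecomposable n1 n2 i1 i2 (hsc hb) (hsc hb') h
    exact ⟨by omega, rfl, rfl⟩

theorem recurrent_zero : v.recurrent 0 = {[]} := by
  ext c
  simp [recurrent, realized_zero]

end UpperPin

/-! ### Power series and exponential growth -/

theorem summable_mul_pow_of_le {a : ℕ → ℝ} (h0 : ∀ k, 0 ≤ a k) (h1 : ∀ k, a k ≤ 2 ^ (k + 2))
    {x : ℝ} (hx0 : 0 ≤ x) (hx : x < 1 / 2) : Summable fun k => a k * x ^ (k + 1) := by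
  refine Summable.of_nonneg_of_le (fun k => mul_nonneg (h0 k) (pow_nonneg hx0 _)) (fun k => ?_)
    ((summable_geometric_of_lt_one (r := 2 * x) (by linarith) (by linarith)).mul_left (4 * x))
  calc a k * x ^ (k + 1) ≤ 2 ^ (k + 2) * x ^ (k + 1) :=
        mul_le_mul_of_nonneg_right (h1 k) (pow_nonneg hx0 _)
    _ = 4 * x * (2 * x) ^ k := by rw [mul_pow]; ring

/-- A power series without constant term whose coefficients are nonnegative and not all zero is
strictly increasing. -/
theorem tsum_mul_pow_lt {a : ℕ → ℝ} (h0 : ∀ k, 0 ≤ a k) (h1 : ∀ k, a k ≤ 2 ^ (k + 2))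
    (ha : 0 < a 0) {x y : ℝ} (hx : 0 ≤ x) (hxy : x < y) (hy : y < 1 / 2) :
    ∑' k, a k * x ^ (k + 1) < ∑' k, a k * y ^ (k + 1) := by
  refine Summable.tsum_lt_tsum (i := 0) (fun k => ?_) ?_
    (summable_mul_pow_of_le h0 h1 hx (hxy.trans hy))
    (summable_mul_pow_of_le h0 h1 (hx.trans hxy.le) hy)
  · exact mul_le_mul_of_nonneg_left (pow_le_pow_left₀ hx hxy.le _) (h0 k)
  · simpa using mul_lt_mul_of_pos_left hxy ha

/-- After multiplication by `x ^ (n + 1)` the recursion bounds the next normalised value by a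
combination of earlier ones with total weight at most 1. The next lemma is the reverse estimate. -/
theorem mul_pow_le_one_of_le_sum {f a : ℕ → ℝ} {x : ℝ} (hx : 0 ≤ x) (ha : ∀ k, 0 ≤ a k)
    (h0 : f 0 ≤ 1) (hf : ∀ n, f (n + 1) ≤ ∑ k ∈ Finset.range (n + 1), a k * f (n - k))
    (hs : ∀ n, ∑ k ∈ Finset.range n, a k * x ^ (k + 1) ≤ 1) (n : ℕ) : f n * x ^ n ≤ 1 := by
  induction n using Nat.strong_induction_on with
  | _ n ih =>
    cases n with
    | zero => simpa using h0
    | succ n =>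
      calc f (n + 1) * x ^ (n + 1)
          ≤ (∑ k ∈ Finset.range (n + 1), a k * f (n - k)) * x ^ (n + 1) :=
            mul_le_mul_of_nonneg_right (hf n) (pow_nonneg hx _)
        _ = ∑ k ∈ Finset.range (n + 1), a k * x ^ (k + 1) * (f (n - k) * x ^ (n - k)) := by
            rw [Finset.sum_mul]
            refine Finset.sum_congr rfl fun k hk => ?_
            have hk' : k ≤ n := by simpa [Nat.lt_succ_iff] using hk
            rw [show n + 1 = (k + 1) + (n - k) by omega, pow_add]
            ring
        _ ≤ ∑ k ∈ Finset.range (n + 1), a k * x ^ (k + 1) :=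
            Finset.sum_le_sum fun k _ => mul_le_of_le_one_right
              (mul_nonneg (ha k) (pow_nonneg hx _)) (ih _ (by omega))
        _ ≤ 1 := hs _

theorem exists_le_mul_pow_of_sum_le {f a : ℕ → ℝ} {x : ℝ} {K : ℕ} (hx : 0 < x)
    (ha : ∀ k, 0 ≤ a k) (ha0 : 0 < a 0) (h0 : 0 < f 0)
    (hf : ∀ n, ∑ k ∈ Finset.range (n + 1), a k * f (n - k) ≤ f (n + 1))
    (hs : 1 ≤ ∑ k ∈ Finset.range K, a k * x ^ (k + 1)) : ∃ c > 0, ∀ n, c ≤ f n * x ^ n := by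
  have hpos : ∀ n, 0 < f n := by
    intro n
    induction n using Nat.strong_induction_on with
    | _ n ih =>
      cases n with
      | zero => exact h0
      | succ n =>
        refine lt_of_lt_of_le ?_ (hf n)
        refine Finset.sum_pos' (fun k _ => mul_nonneg (ha k) (ih _ (by omega)).le)
          ⟨0, by simp, mul_pos ha0 (ih _ (by omega))⟩
  have hc : ∀ N, ∃ c > 0, ∀ n < N, c ≤ f n * x ^ n := by
    intro N
    induction N with
    | zero => exact ⟨1, one_pos, by simp⟩
    | succ N ih =>
      obtain ⟨c, hc, h⟩ := ih
      refine ⟨min c (f N * x ^ N), lt_min hc (mul_pos (hpos N) (pow_pos hx N)), fun n hn => ?_⟩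
      rcases Nat.lt_succ_iff_lt_or_eq.1 hn with hn | rfl
      · exact (min_le_left _ _).trans (h n hn)
      · exact min_le_right _ _
  -- From `K + 1` on, the recursion contains all of the first `K` weights, whose sum is at least 1;
  -- so a lower bound for the initial values persists.
  obtain ⟨c, hc0, hc⟩ := hc (K + 1)
  refine ⟨c, hc0, fun n => ?_⟩
  induction n using Nat.strong_induction_on with
  | _ n ih =>
    by_cases hn : n < K + 1
    · exact hc n hn
    obtain ⟨m, rfl⟩ : ∃ m, n = m + 1 := ⟨n - 1, by omega⟩
    calc c ≤ (∑ k ∈ Finset.range K, a k * x ^ (k + 1)) * c := le_mul_of_one_le_left hc0.le hs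
      _ ≤ ∑ k ∈ Finset.range K, a k * x ^ (k + 1) * (f (m - k) * x ^ (m - k)) := by
          rw [Finset.sum_mul]
          exact Finset.sum_le_sum fun k _ => mul_le_mul_of_nonneg_left (ih _ (by omega))
            (mul_nonneg (ha k) (pow_nonneg hx.le _))
      _ ≤ ∑ k ∈ Finset.range (m + 1), a k * x ^ (k + 1) * (f (m - k) * x ^ (m - k)) := by
          refine Finset.sum_le_sum_of_subset_of_nonneg (fun k hk => ?_) fun k _ _ =>
            mul_nonneg (mul_nonneg (ha k) (pow_nonneg hx.le _))
              (mul_nonneg (hpos _).le (pow_nonneg hx.le _))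
          simp at hk ⊢
          omega
      _ = (∑ k ∈ Finset.range (m + 1), a k * f (m - k)) * x ^ (m + 1) := by
          rw [Finset.sum_mul]
          refine Finset.sum_congr rfl fun k hk => ?_
          have hk' : k ≤ m := by simpa [Nat.lt_succ_iff] using hk
          rw [show m + 1 = (k + 1) + (m - k) by omega, pow_add]
          ring
      _ ≤ f (m + 1) * x ^ (m + 1) := mul_le_mul_of_nonneg_right (hf m) (pow_nonneg hx.le _)

theorem tendsto_const_rpow_one_div {c : ℝ} (hc : 0 < c) :
    Tendsto (fun n : ℕ => c ^ (1 / (n : ℝ))) atTop (𝓝 1) := by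
  have := (tendsto_const_nhds (x := c) (f := atTop)).rpow
    (tendsto_one_div_atTop_nhds_zero_nat (𝕜 := ℝ)) (Or.inl hc.ne')
  simpa using this

/-- Exponential upper and lower bounds determine the growth rate. -/
theorem tendsto_rpow_one_div_of_bounds {f : ℕ → ℝ} (hf : ∀ n, 0 ≤ f n) {ρ b : ℝ} (hρ : 0 < ρ)
    (hb : ρ < b) (hup : ∀ x, 0 < x → x < ρ → ∃ c, ∀ n, f n * x ^ n ≤ c)
    (hlow : ∀ x, ρ < x → x < b → ∃ c > 0, ∀ n, c ≤ f n * x ^ n) :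
    Tendsto (fun n : ℕ => f n ^ (1 / (n : ℝ))) atTop (𝓝 ρ⁻¹) := by
  have hroot : ∀ x > 0, ∀ n : ℕ, n ≠ 0 →
      (f n * x ^ n) ^ (1 / (n : ℝ)) = f n ^ (1 / (n : ℝ)) * x := by
    intro x hx n hn
    rw [Real.mul_rpow (hf n) (pow_nonneg hx.le _), one_div, Real.pow_rpow_inv_natCast hx.le hn]
  refine tendsto_order.2 ⟨fun y hy => ?_, fun y hy => ?_⟩
  · have hyρ : y * ρ < 1 := by rwa [← lt_div_iff₀ hρ, one_div]
    -- With `x` slightly above `ρ` the bound gives roots of at least about `1/x`, and `y * x < 1`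
    -- makes this exceed `y`; the constant disappears in the `n`-th root.
    obtain ⟨x, hxy, hx⟩ : ∃ x, y * x < 1 ∧ x ∈ Set.Ioo ρ b := by
      have h1 : ∀ᶠ x in 𝓝[>] ρ, y * x < 1 :=
        (((continuous_const.mul continuous_id).tendsto ρ).eventually_lt_const hyρ).filter_mono
          nhdsWithin_le_nhds
      exact (h1.and (Ioo_mem_nhdsGT hb)).exists
    have hx0 : 0 < x := hρ.trans hx.1
    obtain ⟨c, hc0, hc⟩ := hlow x hx.1 hx.2
    filter_upwards [(tendsto_const_rpow_one_div hc0).eventually_const_lt hxy,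
      eventually_ne_atTop 0] with n hn hn0
    have h2 := Real.rpow_le_rpow hc0.le (hc n) (by positivity : (0 : ℝ) ≤ 1 / (n : ℝ))
    rw [hroot x hx0 n hn0] at h2
    exact lt_of_mul_lt_mul_right (hn.trans_le h2) hx0.le
  · have hy0 : 0 < y := (inv_pos.2 hρ).trans hy
    obtain ⟨x, hyx, hxρ⟩ := exists_between (inv_lt_of_inv_lt₀ hρ hy)
    have hx0 : 0 < x := (inv_pos.2 hy0).trans hyx
    obtain ⟨c, hc⟩ := hup x hx0 hxρ
    have hc1 : ∀ n, f n * x ^ n ≤ max c 1 := fun n => (hc n).trans (le_max_left _ _)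
    have hc0 : 0 < max c 1 := lt_max_of_lt_right one_pos
    have hyx' : 1 < y * x := by rwa [inv_lt_iff_one_lt_mul₀' hy0] at hyx
    filter_upwards [(tendsto_const_rpow_one_div hc0).eventually_lt_const hyx',
      eventually_ne_atTop 0] with n hn hn0
    have h2 := Real.rpow_le_rpow (mul_nonneg (hf n) (pow_nonneg hx0.le _)) (hc1 n)
      (by positivity : (0 : ℝ) ≤ 1 / (n : ℝ))
    rw [hroot x hx0 n hn0] at h2
    exact lt_of_mul_lt_mul_right (h2.trans_lt hn) hx0.le

/-! ### The growth rate of the codes -/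

namespace UpperPin

variable (v : UpperPin)

/-- The number of codes of good runs of length `k + 1` that occur arbitrarily far out. -/
noncomputable def runCount (k : ℕ) : ℝ := (v.recurrentRuns (k + 1)).ncard

theorem runCount_nonneg (k : ℕ) : 0 ≤ v.runCount k := Nat.cast_nonneg _

theorem runCount_le (k : ℕ) : v.runCount k ≤ 2 ^ (k + 2) := by
  unfold runCount
  exact_mod_cast v.ncard_recurrentRuns_le (k + 1)

/-- The generating function of the codes of good runs that occur arbitrarily far out. -/
noncomputable def runSeries (x : ℝ) : ℝ := ∑' k, v.runCount k * x ^ (k + 1)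

theorem summable_runSeries {x : ℝ} (hx0 : 0 ≤ x) (hx : x < 1 / 2) :
    Summable fun k => v.runCount k * x ^ (k + 1) :=
  summable_mul_pow_of_le v.runCount_nonneg v.runCount_le hx0 hx

theorem runSeries_strictMonoOn (h : 0 < v.runCount 0) :
    StrictMonoOn v.runSeries (Set.Ico 0 (1 / 2)) := fun _ hx _ hy hxy =>
  tsum_mul_pow_lt v.runCount_nonneg v.runCount_le h hx.1 hxy hy.2

/-- The codes of runs from `m` on include non-recurrent ones, but their series tends to `runSeries
x` as `m` grows, by dominated convergence. Hence some `M` has a series below 1, which bounds the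
codes from `M` on. Each of the `M` initial positions then costs at most a factor `(1 - x)⁻¹`. -/
theorem exists_realized_bound {x : ℝ} (hx0 : 0 ≤ x) (hx : x < 1 / 2) (h : v.runSeries x < 1) :
    ∃ c, ∀ n, ((v.realized 0 n).ncard : ℝ) * x ^ n ≤ c := by
  have hle : ∀ m k, ((v.runCodes m (k + 1)).ncard : ℝ) ≤ 2 ^ (k + 2) := fun m k => by
    exact_mod_cast (v.finite_and_ncard_runCodes_le m (k + 1)).2
  have hlim : Tendsto (fun m => ∑' k, ((v.runCodes m (k + 1)).ncard : ℝ) * x ^ (k + 1)) atTop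
      (𝓝 (v.runSeries x)) := by
    refine tendsto_tsum_of_dominated_convergence (bound := fun k => 2 ^ (k + 2) * x ^ (k + 1))
      (summable_mul_pow_of_le (fun k => by positivity) (fun k => le_rfl) hx0 hx) (fun k => ?_)
      (Eventually.of_forall fun m k => ?_)
    · refine tendsto_const_nhds.congr' ?_
      filter_upwards [v.eventually_runCodes_eq (k + 1)] with m hm
      rw [hm, runCount]
    · rw [Real.norm_of_nonneg (mul_nonneg (Nat.cast_nonneg _) (pow_nonneg hx0 _))]
      exact mul_le_mul_of_nonneg_right (hle m k) (pow_nonneg hx0 _)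
  obtain ⟨M, hM⟩ := (hlim.eventually_lt_const h).exists
  have hbase : ∀ n, ((v.realized M n).ncard : ℝ) * x ^ n ≤ 1 := by
    refine mul_pow_le_one_of_le_sum (a := fun k => ((v.runCodes M (k + 1)).ncard : ℝ)) hx0
      (fun k => Nat.cast_nonneg _) (by simp [realized_zero])
      (fun n => by exact_mod_cast v.ncard_realized_succ_le M n) fun n => ?_
    exact ((summable_mul_pow_of_le (fun k => Nat.cast_nonneg _) (hle M) hx0 hx).sum_le_tsum _
      fun k _ => mul_nonneg (Nat.cast_nonneg _) (pow_nonneg hx0 _)).trans hM.le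
  have hstep : ∀ m, (∃ c, ∀ n, ((v.realized m n).ncard : ℝ) * x ^ n ≤ c) →
      ∃ c, ∀ n, ((v.realized 0 n).ncard : ℝ) * x ^ n ≤ c := by
    intro m
    induction m with
    | zero => exact id
    | succ m ih =>
      rintro ⟨c, hc⟩
      refine ih ⟨(1 - x)⁻¹ * c, fun n => ?_⟩
      have hc0 : 0 ≤ c := le_trans (by positivity) (hc 0)
      calc ((v.realized m n).ncard : ℝ) * x ^ n
          ≤ (∑ k ∈ Finset.range (n + 1), ((v.realized (m + 1) (n - k)).ncard : ℝ)) * x ^ n := by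
            refine mul_le_mul_of_nonneg_right ?_ (pow_nonneg hx0 _)
            exact_mod_cast v.ncard_realized_le_sum m n
        _ = ∑ k ∈ Finset.range (n + 1),
              x ^ k * (((v.realized (m + 1) (n - k)).ncard : ℝ) * x ^ (n - k)) := by
            rw [Finset.sum_mul]
            refine Finset.sum_congr rfl fun k hk => ?_
            have hk' : k ≤ n := by simpa [Nat.lt_succ_iff] using hk
            rw [mul_left_comm, ← pow_add, Nat.add_sub_cancel' hk']
        _ ≤ ∑ k ∈ Finset.range (n + 1), x ^ k * c :=
            Finset.sum_le_sum fun k _ => mul_le_mul_of_nonneg_left (hc _) (pow_nonneg hx0 _)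
        _ ≤ (1 - x)⁻¹ * c := by
            rw [← Finset.sum_mul, ← tsum_geometric_of_lt_one hx0 (by linarith)]
            exact mul_le_mul_of_nonneg_right
              ((summable_geometric_of_lt_one hx0 (by linarith)).sum_le_tsum _
                fun k _ => pow_nonneg hx0 _) hc0
  exact hstep M ⟨1, hbase⟩

/-- Recurrent codes suffice for the lower bound: a partial sum of the series already exceeds 1, and
unique decoding supplies the recursion. -/
theorem exists_bound_realized {x : ℝ} (hx0 : 0 < x) (hx : x < 1 / 2) (ha : 0 < v.runCount 0)
    (h : 1 < v.runSeries x) : ∃ c > 0, ∀ n, c ≤ ((v.realized 0 n).ncard : ℝ) * x ^ n := by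
  obtain ⟨K, hK⟩ :=
    ((v.summable_runSeries hx0.le hx).hasSum.tendsto_sum_nat.eventually_const_lt h).exists
  obtain ⟨c, hc0, hc⟩ := exists_le_mul_pow_of_sum_le (f := fun n => ((v.recurrent n).ncard : ℝ))
    hx0 v.runCount_nonneg ha (by simp [recurrent_zero])
    (fun n => by unfold runCount; exact_mod_cast v.sum_le_ncard_recurrent_succ n) hK.le
  refine ⟨c, hc0, fun n => (hc n).trans (mul_le_mul_of_nonneg_right ?_ (pow_nonneg hx0.le _))⟩
  exact_mod_cast Set.ncard_le_ncard (show v.recurrent n ⊆ v.realized 0 n from fun _ h => h 0)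
    (v.finite_realized 0 n)

/-- The growth rate is the reciprocal of the solution of `runSeries ρ = 1`. -/
theorem tendsto_ncard_realized {ρ : ℝ} (hρ0 : 0 < ρ) (hρ : ρ < 1 / 2) (ha : 0 < v.runCount 0)
    (h : v.runSeries ρ = 1) :
    Tendsto (fun n : ℕ => ((v.realized 0 n).ncard : ℝ) ^ (1 / (n : ℝ))) atTop (𝓝 ρ⁻¹) := by
  have hm := v.runSeries_strictMonoOn ha
  refine tendsto_rpow_one_div_of_bounds (fun n => Nat.cast_nonneg _) hρ0 hρ
    (fun x hx0 hx => ?_) fun x hx hx1 => ?_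
  · refine v.exists_realized_bound hx0.le (hx.trans hρ) ?_
    rw [← h]
    exact hm ⟨hx0.le, hx.trans hρ⟩ ⟨hρ0.le, hρ⟩ hx
  · refine v.exists_bound_realized (hρ0.trans hx) hx1 ha ?_
    rw [← h]
    exact hm ⟨hρ0.le, hρ⟩ ⟨(hρ0.trans hx).le, hx1⟩ hx

theorem continuousOn_runSeries {b : ℝ} (hb0 : 0 ≤ b) (hb : b < 1 / 2) :
    ContinuousOn v.runSeries (Set.Icc 0 b) := by
  refine continuousOn_tsum (fun k => by fun_prop) (v.summable_runSeries hb0 hb) fun k x hx => ?_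
  rw [Real.norm_of_nonneg (mul_nonneg (v.runCount_nonneg k) (pow_nonneg hx.1 _))]
  exact mul_le_mul_of_nonneg_left (pow_le_pow_left₀ hx.1 hx.2 _) (v.runCount_nonneg k)

theorem exists_runSeries_eq_one {b : ℝ} (hb0 : 0 ≤ b) (hb : b < 1 / 2)
    (h : 1 ≤ v.runSeries b) : ∃ ρ, 0 < ρ ∧ ρ ≤ b ∧ v.runSeries ρ = 1 := by
  have h0 : v.runSeries 0 = 0 := by simp [runSeries]
  obtain ⟨ρ, hρ, h1⟩ := intermediate_value_Icc hb0 (v.continuousOn_runSeries hb0 hb)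
    (show (1 : ℝ) ∈ Set.Icc _ _ from ⟨by rw [h0]; exact zero_le_one, h⟩)
  refine ⟨ρ, lt_of_le_of_ne hρ.1 ?_, hρ.2, h1⟩
  rintro rfl
  rw [h0] at h1
  exact zero_ne_one h1

end UpperPin

/-! ### From gridded permutations to codes -/

/-- A pin sequence in the first two quadrants consists of the letters `l_u`, `r_u`, `u_l`, `u_r`. -/
theorem letter_cases_of_quadrant {w : ℕ → PinLetter} (hw : IsPinSequence w)
    (hq : ∀ i, quadrant (pinPoint w i) = 1 ∨ quadrant (pinPoint w i) = 2) (i : ℕ) :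
    w i = .lu ∨ w i = .ru ∨ w i = .ul ∨ w i = .ur := by
  have h1 := hw.1 i
  have h2 := hq i
  have e1 : ¬ (2 * (i : ℤ) + 4 ≤ 0) := by omega
  have e2 : ¬ (2 * (i : ℤ) + 1 ≤ 0) := by omega
  revert h1 h2
  rcases hi : w i with ⟨a, b⟩
  cases a <;> cases b <;>
    simp [PinDir.IsHorizontal, quadrant, pinPoint, hi, PinDir.vec] <;>
    (repeat' split_ifs) <;> omega

/-- The sides and types of the pins of a pin sequence in the first two quadrants. -/
def UpperPin.ofPinSequence (w : ℕ → PinLetter) (hw : IsPinSequence w)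
    (hq : ∀ i, quadrant (pinPoint w i) = 1 ∨ quadrant (pinPoint w i) = 2) : UpperPin where
  up i := decide ((w i).dir = .up)
  right i := decide ((w i).dir = .right ∨ (w i).mem = .right)
  up_succ i := by
    have h := hw.2 i
    rcases letter_cases_of_quadrant hw hq i with h1 | h1 | h1 | h1 <;>
    rcases letter_cases_of_quadrant hw hq (i + 1) with h2 | h2 | h2 | h2 <;>
    simp_all
  right_succ i hi := by
    have h := hw.2 i
    rcases letter_cases_of_quadrant hw hq i with h1 | h1 | h1 | h1 <;>
    rcases letter_cases_of_quadrant hw hq (i + 1) with h2 | h2 | h2 | h2 <;>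
    simp_all

namespace UpperPin

/-- The distance of a pin from the vertical axis. -/
def dist (v : UpperPin) (i : ℕ) : ℕ := if v.up i then 2 * i + 1 else 2 * i + 4

/-- Heights and distances from the axis both grow with the position, and differ in order only
between neighbours: an up pin is high and close to the axis, a horizontal pin low and far out. -/
theorem cross_iff_dist_lt (v : UpperPin) {a b : ℕ} (hr : v.right a = v.right b)
    (h : v.height a < v.height b) : v.Cross a b ↔ v.dist b < v.dist a := by
  simp only [Cross, hr, true_and]
  have h1 := v.up_succ a
  have h2 := v.up_succ b
  unfold height at h
  unfold dist
  constructor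
  · rintro (rfl | rfl)
    · cases ha : v.up a <;> rw [ha] at h1 <;>
        simp only [ha, h1, Bool.not_true, Bool.not_false, Bool.false_eq_true, reduceIte] at h ⊢ <;>
        omega
    · cases hb : v.up b <;> rw [hb] at h2 <;>
        simp only [hb, h2, Bool.not_true, Bool.not_false, Bool.false_eq_true, reduceIte] at h ⊢ <;>
        omega
  · intro h3
    have hab : a ≠ b := by rintro rfl; exact lt_irrefl _ h
    split_ifs at h h3 <;> omega

theorem dist_injective (v : UpperPin) : Function.Injective v.dist := by
  intro a b h
  unfold dist at h
  split_ifs at h <;> omega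

theorem dist_pos (v : UpperPin) (a : ℕ) : 0 < v.dist a := by
  unfold dist
  split_ifs <;> omega

section Bridge

variable {w : ℕ → PinLetter} (hw : IsPinSequence w)
  (hq : ∀ i, quadrant (pinPoint w i) = 1 ∨ quadrant (pinPoint w i) = 2)

theorem pinPoint_snd (i : ℕ) : (pinPoint w i).2 = (ofPinSequence w hw hq).height i := by
  rcases letter_cases_of_quadrant hw hq i with h | h | h | h <;>
    simp [pinPoint, height, ofPinSequence, h, PinDir.vec]

theorem pinPoint_fst (i : ℕ) : (pinPoint w i).1 =
    if (ofPinSequence w hw hq).right i then ((ofPinSequence w hw hq).dist i : ℤ)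
    else -((ofPinSequence w hw hq).dist i : ℤ) := by
  rcases letter_cases_of_quadrant hw hq i with h | h | h | h <;>
    simp [pinPoint, dist, ofPinSequence, h, PinDir.vec]

theorem pinPoint_fst_neg_iff (i : ℕ) :
    (pinPoint w i).1 < 0 ↔ (ofPinSequence w hw hq).right i = false := by
  have := (ofPinSequence w hw hq).dist_pos i
  rw [pinPoint_fst hw hq]
  cases (ofPinSequence w hw hq).right i
  · simp; omega
  · simp

theorem pinPoint_fst_injective (hw : IsPinSequence w)
    (hq : ∀ i, quadrant (pinPoint w i) = 1 ∨ quadrant (pinPoint w i) = 2) :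
    Function.Injective fun i => (pinPoint w i).1 := by
  intro a b h
  have ha := (ofPinSequence w hw hq).dist_pos a
  have hb := (ofPinSequence w hw hq).dist_pos b
  apply (ofPinSequence w hw hq).dist_injective
  simp only [pinPoint_fst hw hq] at h
  split_ifs at h <;> omega

/-- The horizontal order of two pins of increasing height is determined by their sides and by
whether they cross. -/
theorem pinPoint_fst_lt_iff {a b : ℕ}
    (h : (ofPinSequence w hw hq).height a < (ofPinSequence w hw hq).height b) :
    (pinPoint w a).1 < (pinPoint w b).1 ↔
      if (ofPinSequence w hw hq).right a = (ofPinSequence w hw hq).right b then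
        ((ofPinSequence w hw hq).Cross a b ↔ (ofPinSequence w hw hq).right a = false)
      else (ofPinSequence w hw hq).right a = false := by
  have ha := (ofPinSequence w hw hq).dist_pos a
  have hb := (ofPinSequence w hw hq).dist_pos b
  have hab : (ofPinSequence w hw hq).dist a ≠ (ofPinSequence w hw hq).dist b := fun e => by
    rw [(ofPinSequence w hw hq).dist_injective e] at h
    exact lt_irrefl _ h
  have hx := (ofPinSequence w hw hq).cross_iff_dist_lt (a := a) (b := b)
  rw [pinPoint_fst hw hq, pinPoint_fst hw hq]
  cases h1 : (ofPinSequence w hw hq).right a <;> cases h2 : (ofPinSequence w hw hq).right b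
  · rw [hx (h1.trans h2.symm) h]; simp
  · simp; omega
  · simp
  · rw [hx (h1.trans h2.symm) h]; simp; omega

/-- The witness property in `GriddedPerm.ContainedIn`. -/
def IsEmbedding {n : ℕ} (s : GriddedPerm n) (w : ℕ → PinLetter) (f : Fin n → ℕ) : Prop :=
  Function.Injective f ∧
    (∀ i j : Fin n, i < j ↔ (pinPoint w (f i)).1 < (pinPoint w (f j)).1) ∧
    (∀ i j : Fin n, s.perm i < s.perm j ↔ (pinPoint w (f i)).2 < (pinPoint w (f j)).2) ∧
    (∀ i : Fin n, (i : ℕ) < (s.left : ℕ) ↔ (pinPoint w (f i)).1 < 0) ∧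
    (∀ i : Fin n, (s.perm i : ℕ) < (s.below : ℕ) ↔ (pinPoint w (f i)).2 < 0)

variable {n : ℕ} {s s' : GriddedPerm n} {f f' : Fin n → ℕ}

theorem IsEmbedding.height_lt (hf : IsEmbedding s w f) {q r : Fin n} (h : q < r) :
    (ofPinSequence w hw hq).height (f (s.perm.symm q)) <
      (ofPinSequence w hw hq).height (f (s.perm.symm r)) := by
  have := (hf.2.2.1 (s.perm.symm q) (s.perm.symm r)).1 (by simpa using h)
  simpa [pinPoint_snd hw hq] using this

theorem IsEmbedding.arrange_image (hf : IsEmbedding s w f) :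
    (ofPinSequence w hw hq).arrange (Finset.univ.image f) = List.ofFn (f ∘ s.perm.symm) := by
  refine arrange_eq _ ?_ fun a => ?_
  · rw [List.pairwise_ofFn]
    exact fun i j h => hf.height_lt hw hq h
  · simp only [List.mem_ofFn, Finset.mem_image, Finset.mem_univ, true_and, Function.comp]
    exact ⟨fun ⟨i, h⟩ => ⟨_, h⟩, fun ⟨i, h⟩ => ⟨s.perm i, by simpa using h⟩⟩

theorem IsEmbedding.below_eq_zero (hw : IsPinSequence w)
    (hq : ∀ i, quadrant (pinPoint w i) = 1 ∨ quadrant (pinPoint w i) = 2)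
    (hf : IsEmbedding s w f) : (s.below : ℕ) = 0 := by
  by_contra h
  have h1 : 0 < n := by have := s.below.2; omega
  have := (hf.2.2.2.2 (s.perm.symm ⟨0, h1⟩)).1 (by simpa using Nat.pos_of_ne_zero h)
  rw [pinPoint_snd hw hq] at this
  omega

theorem IsEmbedding.lt_left_iff (hf : IsEmbedding s w f) (r : Fin n) :
    (s.perm.symm r : ℕ) < s.left ↔
      (ofPinSequence w hw hq).right (f (s.perm.symm r)) = false := by
  rw [hf.2.2.2.1, pinPoint_fst_neg_iff hw hq]

theorem IsEmbedding.symm_lt_iff (hf : IsEmbedding s w f) {q r : Fin n} (h : q < r) :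
    s.perm.symm q < s.perm.symm r ↔
      if (ofPinSequence w hw hq).right (f (s.perm.symm q)) =
          (ofPinSequence w hw hq).right (f (s.perm.symm r)) then
        ((ofPinSequence w hw hq).Cross (f (s.perm.symm q)) (f (s.perm.symm r)) ↔
          (ofPinSequence w hw hq).right (f (s.perm.symm q)) = false)
      else (ofPinSequence w hw hq).right (f (s.perm.symm q)) = false := by
  rw [hf.2.1, pinPoint_fst_lt_iff hw hq (hf.height_lt hw hq h)]

/-- Sides and crossings determine the horizontal order of any two points listed by height
(`pinPoint_fst_lt_iff`), and conversely. The code therefore carries the same information as the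
permutation and the position of the vertical line; no point lies below the horizontal line. -/
theorem code_image_eq_iff (hf : IsEmbedding s w f) (hf' : IsEmbedding s' w f') :
    (ofPinSequence w hw hq).code (Finset.univ.image f) =
      (ofPinSequence w hw hq).code (Finset.univ.image f') ↔ s = s' := by
  unfold code
  rw [hf.arrange_image hw hq, hf'.arrange_image hw hq, listCode_eq_iff]
  have hget : ∀ (g : Fin n → ℕ) (r : Fin n), (List.ofFn g).getD r 0 = g r := fun g r => by
    rw [List.getD_eq_getElem _ _ (by simp)]; simp
  simp only [List.length_ofFn, true_and]
  constructor
  · intro h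
    have hside : ∀ r : Fin n, (ofPinSequence w hw hq).right (f (s.perm.symm r)) =
        (ofPinSequence w hw hq).right (f' (s'.perm.symm r)) := fun r => by
      simpa only [hget, Function.comp] using (h r r.2).1
    have hcross : ∀ q r : Fin n, q < r →
        ((ofPinSequence w hw hq).Cross (f (s.perm.symm q)) (f (s.perm.symm r)) ↔
        (ofPinSequence w hw hq).Cross (f' (s'.perm.symm q)) (f' (s'.perm.symm r))) :=
      fun q r hqr => by
        simpa only [hget, Function.comp] using (h r r.2).2 q hqr
    have hlt : ∀ q r : Fin n, q < r →
        (s.perm.symm q < s.perm.symm r ↔ s'.perm.symm q < s'.perm.symm r) := by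
      intro q r hqr
      rw [hf.symm_lt_iff hw hq hqr, hf'.symm_lt_iff hw hq hqr, hside q, hside r, hcross q r hqr]
    have hlt' : ∀ q r : Fin n,
        s.perm.symm q < s.perm.symm r → s'.perm.symm q < s'.perm.symm r := by
      intro q r h1
      rcases lt_trichotomy q r with h2 | rfl | h2
      · exact (hlt q r h2).1 h1
      · exact absurd h1 (lt_irrefl _)
      · have := (hlt r q h2).not.1 (not_lt.2 h1.le)
        refine lt_of_le_of_ne (not_lt.1 this) fun e => ?_
        exact h2.ne' (s'.perm.symm.injective e)
    -- A monotone permutation of `Fin n` is the identity, so the two permutations agree.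
    have hmono : Monotone (s.perm.trans s'.perm.symm) := by
      refine StrictMono.monotone fun a b hab => ?_
      simpa using hlt' (s.perm a) (s.perm b) (by simpa using hab)
    have hperm : s.perm = s'.perm := by
      have := (Equiv.Perm.monotone_iff _).1 hmono
      refine Equiv.ext fun a => ?_
      have h1 := Equiv.congr_fun this a
      exact s'.perm.symm_apply_eq.1 h1
    refine GriddedPerm.ext hperm (Fin.ext ?_) (Fin.ext ?_)
    · have hi : ∀ i : Fin n, (i : ℕ) < s.left ↔ (i : ℕ) < s'.left := fun i => by
        have h1 := hf.lt_left_iff hw hq (s.perm i)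
        have h2 := hf'.lt_left_iff hw hq (s.perm i)
        have h3 : s'.perm.symm (s.perm i) = i := by rw [hperm]; simp
        rw [hside, ← h2, h3] at h1
        simpa using h1
      have l1 := s.left.2
      have l2 := s'.left.2
      by_contra hne
      rcases lt_or_gt_of_ne hne with h1 | h1
      · have := (hi ⟨s.left, by omega⟩).2 h1
        exact lt_irrefl _ this
      · have := (hi ⟨s'.left, by omega⟩).1 h1
        exact lt_irrefl _ this
    · rw [hf.below_eq_zero hw hq, hf'.below_eq_zero hw hq]
  · rintro rfl r hr
    have hside : ∀ r : Fin n, (ofPinSequence w hw hq).right (f (s.perm.symm r)) =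
        (ofPinSequence w hw hq).right (f' (s.perm.symm r)) := fun r => by
      have h1 := hf.lt_left_iff hw hq r
      rw [hf'.lt_left_iff hw hq r] at h1
      rw [Bool.eq_iff_iff, ← not_iff_not]
      simpa using h1.symm
    have hgr := fun g : Fin n → ℕ => hget g ⟨r, hr⟩
    simp only at hgr
    rw [hgr, hgr]
    refine ⟨hside _, fun q hqr => ?_⟩
    have hgq := fun g : Fin n → ℕ => hget g ⟨q, hqr.trans hr⟩
    simp only at hgq
    rw [hgq, hgq]
    have h1 := hf.symm_lt_iff hw hq (q := ⟨q, hqr.trans hr⟩) (r := ⟨r, hr⟩) hqr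
    have h2 := hf'.symm_lt_iff hw hq (q := ⟨q, hqr.trans hr⟩) (r := ⟨r, hr⟩) hqr
    rw [h2, hside, hside] at h1
    by_cases h3 : (ofPinSequence w hw hq).right (f' (s.perm.symm ⟨q, hqr.trans hr⟩)) =
        (ofPinSequence w hw hq).right (f' (s.perm.symm ⟨r, hr⟩))
    · simp only [h3, if_true] at h1
      simp only [Function.comp]
      tauto
    · refine iff_of_false (fun h => h3 ?_) fun h => h3 h.1
      rw [← hside, ← hside]
      exact h.1

theorem exists_isEmbedding (hw : IsPinSequence w)
    (hq : ∀ i, quadrant (pinPoint w i) = 1 ∨ quadrant (pinPoint w i) = 2)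
    (S : Finset ℕ) (hS : S.card = n) :
    ∃ (s : GriddedPerm n) (f : Fin n → ℕ), IsEmbedding s w f ∧ Finset.univ.image f = S := by
  set v := ofPinSequence w hw hq with hv
  have hlen : (v.arrange S).length = n := by simp [hS]
  let g : Fin n → ℕ := fun i => (v.arrange S)[i]'(by rw [hlen]; exact i.2)
  have hg : ∀ i j : Fin n, i < j → v.height (g i) < v.height (g j) := fun i j h =>
    List.pairwise_iff_getElem.1 (v.pairwise_arrange S) i j _ _ h
  have hgm : StrictMono fun i => v.height (g i) := fun i j h => hg i j h
  have hginj : Function.Injective g := fun i j h => hgm.injective (congrArg v.height h)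
  let x : Fin n → ℤ := fun i => (pinPoint w (g i)).1
  -- `g` lists the positions by height, and `σ` sends a horizontal rank to the height rank of the
  -- same point; this is the required permutation.
  let σ := Tuple.sort x
  have hmono : Monotone (x ∘ σ) := Tuple.monotone_sort x
  have hxinj : Function.Injective (x ∘ σ) :=
    ((pinPoint_fst_injective hw hq).comp hginj).comp σ.injective
  have hstrict : StrictMono (x ∘ σ) := hmono.strictMono_of_injective hxinj
  let L : Finset (Fin n) := Finset.univ.filter fun i => (x ∘ σ) i < 0
  refine ⟨⟨σ, ⟨L.card, ?_⟩, 0⟩, g ∘ σ, ⟨hginj.comp σ.injective, fun i j => ?_, fun i j => ?_,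
    fun i => ?_, fun i => ?_⟩, ?_⟩
  · exact Nat.lt_succ_of_le (by simpa using Finset.card_le_univ L)
  · exact hstrict.lt_iff_lt.symm
  · simp only [pinPoint_snd hw hq, Function.comp, Nat.cast_lt]
    exact hgm.lt_iff_lt.symm
  · exact Tuple.lt_card_lt_iff_apply_lt_of_monotone (f := x ∘ σ) (a := 0) (j := i) hmono
  · simp [pinPoint_snd hw hq]
  · ext a
    simp only [Finset.mem_image, Finset.mem_univ, true_and, Function.comp]
    rw [← v.mem_arrange, List.mem_iff_getElem]
    constructor
    · rintro ⟨i, rfl⟩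
      exact ⟨σ i, by rw [hlen]; exact (σ i).2, rfl⟩
    · rintro ⟨i, hi, rfl⟩
      exact ⟨σ.symm ⟨i, by omega⟩, by simp [g]⟩

/-- The members of the pin class are in bijection with the codes. -/
theorem ncard_pinClass (n : ℕ) :
    (pinClass w n).ncard = ((ofPinSequence w hw hq).realized 0 n).ncard := by
  refine Set.ncard_congr (fun s hs => (ofPinSequence w hw hq).code
    (Finset.univ.image (Exists.choose (show ∃ f, IsEmbedding s w f from hs)))) ?_ ?_ ?_
  · intro s hs
    have hf := Exists.choose_spec (show ∃ f, IsEmbedding s w f from hs)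
    refine ⟨_, fun _ _ => Nat.zero_le _, ?_, rfl⟩
    rw [Finset.card_image_of_injective _ hf.1]
    simp
  · intro s s' hs hs' h
    have hf := Exists.choose_spec (show ∃ f, IsEmbedding s w f from hs)
    have hf' := Exists.choose_spec (show ∃ f, IsEmbedding s' w f from hs')
    exact (code_image_eq_iff hw hq hf hf').1 h
  · rintro c ⟨S, -, hS, rfl⟩
    obtain ⟨s, f, hf, rfl⟩ := exists_isEmbedding hw hq S hS
    have hs : ∃ f, IsEmbedding s w f := ⟨f, hf⟩
    -- The chosen embedding may differ from `f`, but all embeddings of `s` have the same code.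
    exact ⟨s, hs, (code_image_eq_iff hw hq hs.choose_spec hf).2 rfl⟩

end Bridge

end UpperPin

/-! ### Counting the recurrent codes of runs -/

namespace UpperPin

variable (v : UpperPin)

/-- The type and side of a pin together with the side of the pin two places later. -/
def start (i : ℕ) : Bool × Bool × Bool := (v.up i, v.right i, v.right (i + 2))

/-- Both sides are visited twice in a row by the horizontal pins, infinitely often. -/
def Mixed : Prop :=
  ∀ s, ∃ᶠ i in atTop, v.up i = false ∧ v.right i = s ∧ v.right (i + 2) = s

/-- Eventually the horizontal pins follow the pattern `left, left, right, right`. -/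
def EventuallyAntiperiodic : Prop := ∀ᶠ i in atTop, v.right (i + 4) = !v.right i

theorem up_add_two_mul (i t : ℕ) : v.up (i + 2 * t) = v.up i := by simp [v.up_add]

theorem up_add_two (i : ℕ) : v.up (i + 2) = v.up i := v.up_add_two_mul i 1

/-- The last position of a constant stretch of pins of the same type. -/
theorem exists_last_of_ne {i j : ℕ} (hij : i ≤ j) (hu : v.up i = v.up j)
    (hr : v.right i ≠ v.right j) :
    ∃ t, (∀ s ≤ t, v.right (i + 2 * s) = v.right i) ∧
      v.right (i + 2 * t + 2) = !v.right i := by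
  classical
  have hpar : ∃ t, j = i + 2 * t := by
    obtain ⟨d, rfl⟩ := Nat.exists_eq_add_of_le hij
    rw [v.up_add] at hu
    rcases Nat.mod_two_eq_zero_or_one d with h | h
    · exact ⟨d / 2, by omega⟩
    · simp [h] at hu
  obtain ⟨t₀, rfl⟩ := hpar
  have hex : ∃ t, v.right (i + 2 * t) ≠ v.right i := ⟨t₀, hr.symm⟩
  have hs := Nat.find_spec hex
  have hm : ∀ s < Nat.find hex, v.right (i + 2 * s) = v.right i := fun s hs =>
    not_not.1 (Nat.find_min hex hs)
  obtain ⟨t, ht⟩ : ∃ t, Nat.find hex = t + 1 := by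
    refine ⟨Nat.find hex - 1, ?_⟩
    have : Nat.find hex ≠ 0 := fun h => by
      rw [h] at hs
      exact hs rfl
    omega
  rw [ht] at hs hm
  exact ⟨t, fun s hst => hm s (by omega), Bool.eq_not_of_ne hs⟩

variable {v}

theorem Mixed.frequently_right (hv : v.Mixed) (u s : Bool) :
    ∃ᶠ i in atTop, v.up i = u ∧ v.right i = s ∧ v.right (i + 2) = s := by
  rw [frequently_atTop]
  intro N
  obtain ⟨i, hi, h1, h2, h3⟩ := frequently_atTop.1 (hv s) N
  cases u
  · exact ⟨i, hi, h1, h2, h3⟩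
  · refine ⟨i + 1, by omega, by rw [v.up_succ, h1]; rfl, by rw [v.right_succ i h1, h2], ?_⟩
    rw [show i + 1 + 2 = i + 2 + 1 by omega, v.right_succ _ (by rw [v.up_add_two, h1]), h3]

/-- For equal sides this is the recurrence of `rur` and `lul`. For different sides, take a pin on
side `a` and a later one of the same type on side `b`: the last pin before the first change of side
has the required start. -/
theorem Mixed.frequently_start (hv : v.Mixed) (x : Bool × Bool × Bool) :
    ∃ᶠ i in atTop, v.start i = x := by
  obtain ⟨u, a, b⟩ := x
  by_cases hab : a = b
  · subst hab
    exact (hv.frequently_right u a).mono fun i h => by simp [start, h]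
  · rw [frequently_atTop]
    intro N
    obtain ⟨i, hi, h1, h2, -⟩ := frequently_atTop.1 (hv.frequently_right u a) N
    obtain ⟨j, hj, h3, h4, -⟩ := frequently_atTop.1 (hv.frequently_right u b) i
    obtain ⟨t, ht, ht'⟩ := v.exists_last_of_ne hj (h1.trans h3.symm) (by rwa [h2, h4])
    refine ⟨i + 2 * t, by omega, ?_⟩
    simp only [start, v.up_add_two_mul, h1, ht t le_rfl, h2, ht', Prod.mk.injEq, true_and]
    cases a <;> cases b <;> simp_all

theorem Mixed.frequently_leave (hv : v.Mixed) (a : Bool) :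
    ∃ᶠ i in atTop, v.up i = true ∧ v.right i = a ∧ v.right (i + 2) = a ∧
      v.right (i + 4) = !a := by
  rw [frequently_atTop]
  intro N
  obtain ⟨i, hi, h1, h2, h2'⟩ := frequently_atTop.1 (hv.frequently_right true a) N
  obtain ⟨j, hj, h3, h4, -⟩ := frequently_atTop.1 (hv.frequently_right true (!a)) i
  obtain ⟨t, ht, ht'⟩ := v.exists_last_of_ne hj (h1.trans h3.symm) (by rw [h2, h4]; simp)
  -- The stretch begins with two pins on side `a`, so its last pin is not its first, and the last
  -- two can be used.
  obtain ⟨s, rfl⟩ : ∃ s, t = s + 1 := by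
    refine ⟨t - 1, ?_⟩
    have : t ≠ 0 := by
      rintro rfl
      simp [h2, h2'] at ht'
    omega
  refine ⟨i + 2 * s, by omega, by rw [v.up_add_two_mul, h1], by rw [ht s (by omega), h2], ?_, ?_⟩
  · rw [← h2, ← ht (s + 1) le_rfl]; congr 1
  · rw [← h2, ← ht']; congr 1

variable (v)

/-- A lower bound for the number of recurrent codes: an invariant of the code that takes many values
infinitely often. -/
theorem card_image_le_ncard_recurrentRuns {X Y : Type*} [DecidableEq Y] {k : ℕ} {P : Finset X}
    {τ : ℕ → X} (κ : X → Y) (hP : ∀ x ∈ P, ∃ᶠ i in atTop, τ i = x)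
    (hg : ∀ i, τ i ∈ P → v.Good i k)
    (hκ : ∀ i j, τ i ∈ P → τ j ∈ P → v.code (run i k) = v.code (run j k) → κ (τ i) = κ (τ j)) :
    (P.image κ).card ≤ (v.recurrentRuns k).ncard := by
  obtain ⟨M, hM⟩ := (v.eventually_runCodes_eq k).exists
  have hex : ∀ y ∈ P.image κ, ∃ i, M ≤ i ∧ τ i ∈ P ∧ κ (τ i) = y := by
    intro y hy
    obtain ⟨x, hx, rfl⟩ := Finset.mem_image.1 hy
    obtain ⟨i, hi, rfl⟩ := frequently_atTop.1 (hP x hx) M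
    exact ⟨i, hi, hx, rfl⟩
  choose! f hf using hex
  rw [← Set.ncard_coe_finset]
  refine Set.ncard_le_ncard_of_injOn (fun y => v.code (run (f y) k)) (fun y hy => ?_)
    (fun y hy z hz h => ?_) (v.finite_recurrentRuns k)
  · rw [← hM]
    exact ⟨_, (hf y hy).1, hg _ (hf y hy).2.1, rfl⟩
  · have := hκ _ _ (hf y hy).2.1 (hf z hz).2.1 h
    rwa [(hf y hy).2.2, (hf z hz).2.2] at this

/-- An upper bound for the number of recurrent codes: an invariant that determines the code. -/
theorem ncard_recurrentRuns_le_card_image {X Y : Type*} [DecidableEq Y] {k M : ℕ} {P : Finset X}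
    {τ : ℕ → X} (κ : X → Y) (hg : ∀ i, v.Good i k → τ i ∈ P)
    (hκ : ∀ i j, M ≤ i → M ≤ j → τ i ∈ P → τ j ∈ P → κ (τ i) = κ (τ j) →
      v.code (run i k) = v.code (run j k)) :
    (v.recurrentRuns k).ncard ≤ (P.image κ).card := by
  have hex : ∀ c ∈ v.recurrentRuns k, ∃ i, M ≤ i ∧ v.Good i k ∧ v.code (run i k) = c :=
    fun c hc => hc M
  choose! f hf using hex
  rw [← Set.ncard_coe_finset]
  refine Set.ncard_le_ncard_of_injOn (fun c => κ (τ (f c))) (fun c hc => ?_)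
    (fun c hc d hd h => ?_) (Finset.finite_toSet _)
  · exact Finset.mem_coe.2 (Finset.mem_image_of_mem κ (hg _ (hf c hc).2.1))
  · rw [← (hf c hc).2.2, ← (hf d hd).2.2]
    exact hκ _ _ (hf c hc).1 (hf d hd).1 (hg _ (hf c hc).2.1) (hg _ (hf d hd).2.1) h

theorem good_of_ne_two (i : ℕ) {k : ℕ} (h0 : 0 < k) (h : k ≠ 2) : v.Good i k := ⟨h0, fun h' => h h'.1⟩

theorem right_succ_of_up {i : ℕ} (h : v.up i = true) : v.right (i + 1) = v.right (i + 2) :=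
  (v.right_succ (i + 1) (by rw [v.up_succ, h]; rfl)).symm

theorem right_add_one_eq (i : ℕ) :
    v.right (i + 1) = if v.up i then v.right (i + 2) else v.right i := by
  cases h : v.up i
  · simpa using v.right_succ i h
  · simpa using v.right_succ_of_up h

/-- Equality of codes of runs in terms of the entries by rank. -/
theorem code_run_eq_iff {i j k : ℕ} : v.code (run i k) = v.code (run j k) ↔ ∀ r < k,
    v.right (i + offset (v.up i) k r) = v.right (j + offset (v.up j) k r) ∧
    ∀ q < r, (v.Cross (i + offset (v.up i) k q) (i + offset (v.up i) k r) ↔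
      v.Cross (j + offset (v.up j) k q) (j + offset (v.up j) k r)) := by
  unfold code
  rw [listCode_eq_iff]
  simp only [length_arrange, card_run, true_and]
  refine forall₂_congr fun r hr => ?_
  rw [getD_arrange_run v hr, getD_arrange_run v hr]
  refine and_congr_right fun _ => forall₂_congr fun q hq => ?_
  rw [getD_arrange_run v (hq.trans hr), getD_arrange_run v (hq.trans hr)]

/-- A run of at least four positions is determined by its code. -/
theorem word_eq_of_code_eq {i j k : ℕ} (hk : 4 ≤ k) (h : v.code (run i k) = v.code (run j k)) :
    v.up i = v.up j ∧ ∀ a < k, v.right (i + a) = v.right (j + a) := by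
  rw [code_run_eq_iff] at h
  -- The points of rank 0 and 2 reveal the type of the first pin: they are `i, i + 1` if it is
  -- horizontal and `i + 1, i + 3` if it is an up pin. The latter needs `k ≥ 4`; for `k = 3` the
  -- point of rank 2 would be `i + 2`, which crosses `i + 1`.
  have hu : ∀ i, v.Cross (i + offset (v.up i) k 0) (i + offset (v.up i) k 2) ↔ v.up i = false := by
    intro i
    have h1 : 0 + 1 < k := by omega
    have h3 : 2 + 1 < k := by omega
    cases hi : v.up i
    · simpa [offset] using v.cross_succ hi
    · simp only [offset, Cross]
      simp [h1, h3]
  have hup : v.up i = v.up j := by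
    have := (h 2 (by omega)).2 0 (by omega)
    rw [hu, hu] at this
    cases hi : v.up i <;> cases hj : v.up j <;> simp_all
  refine ⟨hup, fun a ha => ?_⟩
  have hmem : i + a ∈ v.arrange (run i k) := by simp [run, ha]
  rw [arrange_run] at hmem
  obtain ⟨r, hr, he⟩ := List.mem_map.1 hmem
  have hr' : r < k := List.mem_range.1 hr
  have he' : offset (v.up i) k r = a := by omega
  have := (h r hr').1
  rwa [← hup, he'] at this

theorem ncard_recurrentRuns_one (hv : v.Mixed) : (v.recurrentRuns 1).ncard = 2 := by
  have hcode : ∀ i j, v.code (run i 1) = v.code (run j 1) ↔ v.right i = v.right j := by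
    intro i j
    have h0 : ∀ u, offset u 1 0 = 0 := by decide
    rw [code_run_eq_iff]
    simp [h0]
  have hc : ((Finset.univ : Finset (Bool × Bool × Bool)).image fun x => x.2.1).card = 2 := by
    decide
  rw [← hc]
  refine le_antisymm ?_ ?_
  · exact v.ncard_recurrentRuns_le_card_image (M := 0) (τ := v.start) _ (fun _ _ => Finset.mem_univ _)
      fun i j _ _ _ _ h => (hcode i j).2 h
  · exact v.card_image_le_ncard_recurrentRuns (τ := v.start) _ (fun x _ => hv.frequently_start x)
      (fun i _ => v.good_of_ne_two i (by omega) (by omega)) fun i j _ _ h => (hcode i j).1 h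

/-- A good run of length 2 consists of two crossing points on one side, whichever type comes first,
so only the side matters. -/
theorem ncard_recurrentRuns_two (hv : v.Mixed) : (v.recurrentRuns 2).ncard = 2 := by
  let P : Finset (Bool × Bool × Bool) := Finset.univ.filter fun x => x.1 = true → x.2.1 = x.2.2
  have hP : ∀ i, v.start i ∈ P ↔ v.Good i 2 := by
    intro i
    simp only [P, start, Good, Finset.mem_filter, Finset.mem_univ, true_and]
    have := v.right_add_one_eq i
    cases hu : v.up i <;> simp_all
  have hr : ∀ i, v.start i ∈ P → v.right (i + 1) = v.right i := by
    intro i hi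
    have := v.right_add_one_eq i
    simp only [P, start, Finset.mem_filter, Finset.mem_univ, true_and] at hi
    cases hu : v.up i <;> simp_all
  have hcode : ∀ i j, v.start i ∈ P → v.start j ∈ P →
      (v.code (run i 2) = v.code (run j 2) ↔ v.right i = v.right j) := by
    intro i j hi hj
    have e1 := hr i hi
    have e2 := hr j hj
    have o : offset false 2 0 = 0 ∧ offset false 2 1 = 1 ∧ offset true 2 0 = 1 ∧
      offset true 2 1 = 0 := by decide
    rw [code_run_eq_iff]
    constructor
    · intro h
      have := (h 0 (by omega)).1
      cases h1 : v.up i <;> cases h2 : v.up j <;> simp_all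
    · intro h r hr
      interval_cases r <;> cases h1 : v.up i <;> cases h2 : v.up j <;> simp_all [Cross]
  have hc : (P.image fun x => x.2.1).card = 2 := by decide
  rw [← hc]
  refine le_antisymm ?_ ?_
  · exact v.ncard_recurrentRuns_le_card_image (M := 0) (τ := v.start) _ (fun i h => (hP i).2 h)
      fun i j _ _ hi hj h => (hcode i j hi hj).2 h
  · exact v.card_image_le_ncard_recurrentRuns (τ := v.start) _ (fun x _ => hv.frequently_start x)
      (fun i h => (hP i).1 h) fun i j hi hj h => (hcode i j hi hj).1 h

theorem ncard_recurrentRuns_three (hv : v.Mixed) : (v.recurrentRuns 3).ncard = 6 := by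
  -- `κ` records the sides of the points of rank 0 and 1, and whether rank 1 crosses rank 0 and rank
  -- 2. Ranks 0 and 2 always cross. For `a ≠ b` the starts `(true, a, b)` and `(false, b, a)` have
  -- the same value, so eight starts give six codes.
  let κ : Bool × Bool × Bool → Bool × Bool × Bool × Bool := fun x =>
    (if x.1 then x.2.2 else x.2.1, if x.1 then x.2.1 else x.2.2,
      x.1 && x.2.1 == x.2.2, !x.1 && x.2.1 == x.2.2)
  have o : offset false 3 0 = 0 ∧ offset false 3 1 = 2 ∧ offset false 3 2 = 1 ∧
      offset true 3 0 = 1 ∧ offset true 3 1 = 0 ∧ offset true 3 2 = 2 := by decide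
  obtain ⟨o1, o2, o3, o4, o5, o6⟩ := o
  have hne : ∀ m : ℕ, m + 2 + 1 ≠ m := fun m => by omega
  have hcode : ∀ i j, v.code (run i 3) = v.code (run j 3) ↔ κ (v.start i) = κ (v.start j) := by
    intro i j
    have e1 := v.right_add_one_eq i
    have e2 := v.right_add_one_eq j
    rw [code_run_eq_iff]
    simp only [κ, start]
    constructor
    · intro h
      have h0 := (h 0 (by omega)).1
      have h1 := (h 1 (by omega)).1
      have h2 := (h 1 (by omega)).2 0 (by omega)
      have h3 := (h 2 (by omega)).2 1 (by omega)
      clear h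
      cases hi : v.up i <;> cases hj : v.up j <;>
        simp [hi, hj, o1, o2, o3, o4, o5, o6, Cross, hne] at e1 e2 h0 h1 h2 h3 ⊢ <;> grind
    · intro h r hr
      cases hi : v.up i <;> cases hj : v.up j <;> simp [hi, hj] at h e1 e2 <;>
        interval_cases r <;> refine ⟨?_, fun q hq => ?_⟩ <;> try interval_cases q
      all_goals simp [o1, o2, o3, o4, o5, o6, Cross, hne] <;> grind
  have hc : (Finset.univ.image κ).card = 6 := by decide
  rw [← hc]
  refine le_antisymm ?_ ?_
  · exact v.ncard_recurrentRuns_le_card_image (M := 0) (τ := v.start) _ (fun _ _ => Finset.mem_univ _)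
      fun i j _ _ _ _ h => (hcode i j).2 h
  · exact v.card_image_le_ncard_recurrentRuns (τ := v.start) _ (fun x _ => hv.frequently_start x)
      (fun i _ => v.good_of_ne_two i (by omega) (by omega)) fun i j _ _ h => (hcode i j).1 h

theorem eight_le_ncard_recurrentRuns (hv : v.Mixed) {k : ℕ} (hk : 4 ≤ k) :
    8 ≤ (v.recurrentRuns k).ncard := by
  have hc : ((Finset.univ : Finset (Bool × Bool × Bool)).image id).card = 8 := by decide
  rw [← hc]
  refine v.card_image_le_ncard_recurrentRuns (τ := v.start) _ (fun x _ => hv.frequently_start x)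
    (fun i _ => v.good_of_ne_two i (by omega) (by omega)) fun i j _ _ h => ?_
  obtain ⟨h1, h2⟩ := v.word_eq_of_code_eq hk h
  simp only [start, id, h1, Prod.mk.injEq, true_and]
  exact ⟨h2 0 (by omega), h2 2 (by omega)⟩

/-- Antiperiodicity continues the sides from the first four places, and these are determined by the
start. -/
theorem ncard_recurrentRuns_le_eight (hE : v.EventuallyAntiperiodic) (k : ℕ) :
    (v.recurrentRuns k).ncard ≤ 8 := by
  have hc : ((Finset.univ : Finset (Bool × Bool × Bool)).image id).card = 8 := by decide
  obtain ⟨M, hM⟩ := eventually_atTop.1 hE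
  rw [← hc]
  refine v.ncard_recurrentRuns_le_card_image (M := M) (τ := v.start) _ (fun _ _ => Finset.mem_univ _)
    fun i j hi hj _ _ h => ?_
  simp only [start, id, Prod.mk.injEq] at h
  obtain ⟨hu, h0, h2⟩ := h
  refine code_run_congr hu fun a _ => ?_
  induction a using Nat.strong_induction_on with
  | _ a ih =>
    have e1 := v.right_add_one_eq i
    have e2 := v.right_add_one_eq j
    have e3 := v.right_add_one_eq (i + 2)
    have e4 := v.right_add_one_eq (j + 2)
    rw [v.up_add_two] at e3 e4
    have e5 := hM i hi
    have e6 := hM j hj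
    match a with
    | 0 => exact h0
    | 1 => rw [e1, e2, hu, h0, h2]
    | 2 => exact h2
    | 3 => simp only [add_assoc, Nat.reduceAdd] at e3 e4; rw [e3, e4, e5, e6, hu, h0, h2]
    | a + 4 =>
      rw [← add_assoc, ← add_assoc, hM _ (by omega), hM _ (by omega), ih a (by omega) (by omega)]

/-- The eight starts already give eight words of length 4. Without antiperiodicity, some start with
an up pin recurs with both possible sides at the fourth place, which gives a ninth. -/
theorem nine_le_ncard_recurrentRuns_four (hv : v.Mixed) (hE : ¬ v.EventuallyAntiperiodic) :
    9 ≤ (v.recurrentRuns 4).ncard := by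
  classical
  let R : Bool → Bool → Bool → Prop := fun a b c => ∃ᶠ i in atTop,
    v.up i = true ∧ v.right i = a ∧ v.right (i + 2) = b ∧ v.right (i + 4) = c
  have hleave : ∀ a, R a a (!a) := fun a => hv.frequently_leave a
  -- some pattern `a b a` recurs
  have h1 : ∃ᶠ i in atTop, v.up i = true ∧ v.right (i + 4) = v.right i := by
    rw [frequently_atTop]
    intro N
    have hE' : ∃ᶠ i in atTop, ¬ v.right (i + 4) = !v.right i :=
      not_eventually.1 hE
    obtain ⟨i, hi, h⟩ := frequently_atTop.1 hE' N
    have h' : v.right (i + 4) = v.right i := by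
      cases h1 : v.right (i + 4) <;> cases h2 : v.right i <;> simp_all
    cases hu : v.up i
    -- If antiperiodicity fails at a horizontal pin, it also fails at the up pin after it, since
    -- both lie on the same side.
    · refine ⟨i + 1, by omega, by rw [v.up_succ, hu]; rfl, ?_⟩
      rw [show i + 1 + 4 = i + 4 + 1 by omega, v.right_succ _ hu,
        v.right_succ _ (by rw [show i + 4 = i + 2 + 2 by omega, v.up_add_two, v.up_add_two, hu]), h']
    · exact ⟨i, hi, hu, h'⟩
  have hR1 : ∃ a b, R a b a := by
    by_contra hno
    push Not at hno
    have hall : ∀ᶠ i in atTop, ∀ a b, ¬ (v.up i = true ∧ v.right i = a ∧ v.right (i + 2) = b ∧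
        v.right (i + 4) = a) :=
      eventually_all.2 fun a => eventually_all.2 fun b => not_frequently.1 (hno a b)
    obtain ⟨i, hi, hi'⟩ := (h1.and_eventually hall).exists
    exact hi' _ _ ⟨hi.1, rfl, rfl, hi.2⟩
  have hR2 : ∀ b, ∃ x, R x b b := by
    intro b
    by_contra hno
    push Not at hno
    have hall : ∀ᶠ i in atTop, ∀ x, ¬ (v.up i = true ∧ v.right i = x ∧ v.right (i + 2) = b ∧
        v.right (i + 4) = b) := eventually_all.2 fun x => not_frequently.1 (hno x)
    obtain ⟨N, hN⟩ := eventually_atTop.1 hall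
    obtain ⟨i, hi, h⟩ := frequently_atTop.1 (hv.frequently_right true b) (N + 2)
    obtain ⟨j, rfl⟩ := Nat.exists_eq_add_of_le' (show 2 ≤ i by omega)
    refine hN j (by omega) _ ⟨by rw [← v.up_add_two, h.1], rfl, h.2.1, h.2.2⟩
  -- A recurring pattern `a b a` is combined with one that shares its first two sides or with a
  -- leaving pattern. If `a = b`, then `a a (!a)` completes the pair. If `a ≠ b`, some `x b b`
  -- recurs: for `x = a` it pairs with `a b a`, and for `x = b` it pairs with `b b (!b)`.
  have hboth : ∃ a b, R a b false ∧ R a b true := by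
    have hcomb : ∀ a b c, R a b c → R a b (!c) → ∃ a b, R a b false ∧ R a b true := by
      intro a b c h h'
      cases c
      · exact ⟨a, b, h, h'⟩
      · exact ⟨a, b, h', h⟩
    obtain ⟨a, b, hab⟩ := hR1
    rcases eq_or_ne a b with rfl | hne
    · exact hcomb a a a hab (hleave a)
    · obtain ⟨x, hx⟩ := hR2 b
      rcases eq_or_ne x b with rfl | hne'
      · exact hcomb x x x hx (hleave x)
      · obtain rfl : x = a := by cases x <;> cases a <;> cases b <;> simp_all
        refine hcomb x b x hab ?_
        rwa [← Bool.eq_not_of_ne hne.symm]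
  let τ : ℕ → (Bool × Bool × Bool) × Bool := fun i => (v.start i, v.right (i + 3))
  let P : Finset ((Bool × Bool × Bool) × Bool) :=
    Finset.univ.filter fun x => ∃ᶠ i in atTop, τ i = x
  have hP : ∀ x, x ∈ P ↔ ∃ᶠ i in atTop, τ i = x := fun x => by simp [P]
  have hle : (P.image id).card ≤ (v.recurrentRuns 4).ncard := by
    refine v.card_image_le_ncard_recurrentRuns (τ := τ) _ (fun x hx => (hP x).1 hx)
      (fun i _ => v.good_of_ne_two i (by omega) (by omega)) fun i j _ _ h => ?_
    obtain ⟨h1, h2⟩ := v.word_eq_of_code_eq le_rfl h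
    simp only [τ, start, id, h1, Prod.mk.injEq, true_and]
    exact ⟨⟨h2 0 (by omega), h2 2 (by omega)⟩, h2 3 (by omega)⟩
  rw [Finset.image_id] at hle
  refine le_trans ?_ hle
  have himg : P.image Prod.fst = Finset.univ := by
    refine Finset.eq_univ_iff_forall.2 fun x => ?_
    by_contra hx
    have hno : ∀ c, ∀ᶠ i in atTop, τ i ≠ (x, c) := fun c =>
      not_frequently.1 fun h => hx (Finset.mem_image.2 ⟨(x, c), (hP _).2 h, rfl⟩)
    obtain ⟨i, hi, hi'⟩ := ((hv.frequently_start x).and_eventually (eventually_all.2 hno)).exists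
    exact hi' (v.right (i + 3)) (by simp [τ, hi])
  have hcard : (P.image Prod.fst).card = 8 := by rw [himg]; decide
  have hninj : ¬ Set.InjOn Prod.fst (P : Set ((Bool × Bool × Bool) × Bool)) := by
    intro hinj
    obtain ⟨a, b, h0, h1⟩ := hboth
    have hmem : ∀ c, R a b c → ((true, a, b), c) ∈ P := fun c hc => by
      refine (hP _).2 (hc.mono fun i hi => ?_)
      obtain ⟨k1, k2, k3, k4⟩ := hi
      have := v.right_add_one_eq (i + 2)
      rw [v.up_add_two, k1] at this
      simp only [τ, start, k1, k2, k3, Prod.mk.injEq, true_and]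
      rw [← k4]
      simpa using this
    have := hinj (hmem _ h0) (hmem _ h1) rfl
    simp at this
  have := lt_of_le_of_ne (Finset.card_image_le (s := P) (f := Prod.fst))
    fun h => hninj (Finset.card_image_iff.1 h)
  omega

end UpperPin

/-! ### Comparison with the minimal series -/

namespace UpperPin

/-- The numbers of codes of runs for the pin sequence `(lulururu)^∞`. -/
def minRunCount (k : ℕ) : ℝ := if k < 2 then 2 else if k = 2 then 6 else 8

/-- The generating function of `minRunCount`. -/
noncomputable def minRunSeries (x : ℝ) : ℝ := ∑' k, minRunCount k * x ^ (k + 1)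

theorem minRunCount_nonneg (k : ℕ) : 0 ≤ minRunCount k := by
  unfold minRunCount; split_ifs <;> norm_num

theorem minRunCount_le (k : ℕ) : minRunCount k ≤ 2 ^ (k + 2) := by
  have h1 : (2 : ℝ) ≤ 2 ^ (k + 2) := by
    calc (2 : ℝ) = 2 ^ 1 := by norm_num
      _ ≤ 2 ^ (k + 2) := pow_le_pow_right₀ one_le_two (by omega)
  unfold minRunCount
  split_ifs with h h'
  · exact h1
  · subst h'; norm_num
  · calc (8 : ℝ) = 2 ^ 3 := by norm_num
      _ ≤ 2 ^ (k + 2) := pow_le_pow_right₀ one_le_two (by omega)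

theorem minRunSeries_eq {x : ℝ} (hx0 : 0 ≤ x) (hx : x < 1 / 2) :
    minRunSeries x = 2 * x + 2 * x ^ 2 + 6 * x ^ 3 + 8 * x ^ 4 * (1 - x)⁻¹ := by
  have hs := summable_mul_pow_of_le minRunCount_nonneg minRunCount_le hx0 hx
  unfold minRunSeries
  rw [← hs.sum_add_tsum_nat_add 3]
  have htail : ∀ k, minRunCount (k + 3) * x ^ (k + 3 + 1) = 8 * x ^ 4 * x ^ k := fun k => by
    rw [minRunCount, if_neg (by omega), if_neg (by omega)]; ring
  simp only [htail]
  rw [tsum_mul_left, tsum_geometric_of_lt_one hx0 (by linarith)]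
  simp [Finset.sum_range_succ, minRunCount]

/-- Multiplying `minRunSeries x = 1` by `1 - x` leaves `1 - 3x - 4x³ - 2x⁴ = 0`, the reciprocal form
of the quartic. -/
theorem minRunSeries_inv {ν : ℝ} (h3 : 3 < ν) (h : ν ^ 4 - 3 * ν ^ 3 - 4 * ν - 2 = 0) :
    minRunSeries ν⁻¹ = 1 := by
  have h0 : ν ≠ 0 := by linarith
  have h1 : ν - 1 ≠ 0 := by linarith
  rw [minRunSeries_eq (by positivity) (by
    rw [← one_div]; exact one_div_lt_one_div_of_lt (by norm_num) (by linarith))]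
  rw [show (1 : ℝ) - ν⁻¹ = (ν - 1) / ν by field_simp]
  field_simp
  linear_combination (-1 : ℝ) * h

variable {v : UpperPin}

theorem Mixed.minRunCount_le_runCount (hv : v.Mixed) (k : ℕ) : minRunCount k ≤ v.runCount k := by
  unfold runCount minRunCount
  match k with
  | 0 => simp [v.ncard_recurrentRuns_one hv]
  | 1 => simp [v.ncard_recurrentRuns_two hv]
  | 2 => simp [v.ncard_recurrentRuns_three hv]
  | k + 3 =>
    rw [if_neg (by omega), if_neg (by omega)]
    exact_mod_cast v.eight_le_ncard_recurrentRuns hv (by omega)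

theorem Mixed.runCount_eq (hv : v.Mixed) (hE : v.EventuallyAntiperiodic) (k : ℕ) :
    v.runCount k = minRunCount k := by
  refine le_antisymm ?_ (hv.minRunCount_le_runCount k)
  unfold runCount minRunCount
  match k with
  | 0 => simp [v.ncard_recurrentRuns_one hv]
  | 1 => simp [v.ncard_recurrentRuns_two hv]
  | 2 => simp [v.ncard_recurrentRuns_three hv]
  | k + 3 =>
    rw [if_neg (by omega), if_neg (by omega)]
    exact_mod_cast v.ncard_recurrentRuns_le_eight hE _

theorem Mixed.runCount_zero_pos (hv : v.Mixed) : 0 < v.runCount 0 :=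
  lt_of_lt_of_le (by norm_num [minRunCount]) (hv.minRunCount_le_runCount 0)

theorem Mixed.minRunSeries_lt (hv : v.Mixed) (hE : ¬ v.EventuallyAntiperiodic) {x : ℝ}
    (hx0 : 0 < x) (hx : x < 1 / 2) : minRunSeries x < v.runSeries x := by
  refine Summable.tsum_lt_tsum (i := 3)
    (fun k => mul_le_mul_of_nonneg_right (hv.minRunCount_le_runCount k) (pow_nonneg hx0.le _)) ?_
    (summable_mul_pow_of_le minRunCount_nonneg minRunCount_le hx0.le hx)
    (v.summable_runSeries hx0.le hx)
  refine mul_lt_mul_of_pos_right ?_ (pow_pos hx0 _)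
  have h9 : (9 : ℝ) ≤ v.runCount 3 := by
    unfold runCount
    exact_mod_cast v.nine_le_ncard_recurrentRuns_four hv hE
  refine lt_of_lt_of_le ?_ h9
  norm_num [minRunCount]

/-- The growth rate of the codes exists and is at least the extremal one. -/
theorem Mixed.exists_growth (hv : v.Mixed) {ν : ℝ} (h3 : 10 / 3 < ν)
    (h : ν ^ 4 - 3 * ν ^ 3 - 4 * ν - 2 = 0) :
    ∃ g, Tendsto (fun n : ℕ => ((v.realized 0 n).ncard : ℝ) ^ (1 / (n : ℝ))) atTop (𝓝 g) ∧
      ν ≤ g ∧ (g = ν ↔ v.EventuallyAntiperiodic) := by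
  have hν0 : 0 < ν := by linarith
  have hνi : ν⁻¹ < 3 / 10 := by rw [inv_lt_comm₀ hν0 (by norm_num)]; linarith
  have hνi0 : 0 < ν⁻¹ := inv_pos.2 hν0
  have hone := minRunSeries_inv (by linarith) h
  by_cases hE : v.EventuallyAntiperiodic
  · refine ⟨ν, ?_, le_rfl, by simp [hE]⟩
    have hs : v.runSeries ν⁻¹ = 1 := by
      rw [← hone]
      exact tsum_congr fun k => by rw [hv.runCount_eq hE]
    simpa using v.tendsto_ncard_realized hνi0 (by linarith) hv.runCount_zero_pos hs
  · have hlt := hv.minRunSeries_lt hE hνi0 (by linarith)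
    rw [hone] at hlt
    obtain ⟨ρ, hρ0, hρ1, hρ⟩ := v.exists_runSeries_eq_one hνi0.le (by linarith) hlt.le
    have hlt' : ρ < ν⁻¹ := lt_of_le_of_ne hρ1 (by rintro rfl; linarith)
    have hg : ν < ρ⁻¹ := (lt_inv_comm₀ hν0 hρ0).2 hlt'
    exact ⟨ρ⁻¹, v.tendsto_ncard_realized hρ0 (by linarith) hv.runCount_zero_pos hρ, hg.le,
      iff_of_false hg.ne' hE⟩

section PinSequence

variable {w : ℕ → PinLetter} (hw : IsPinSequence w)
  (hq : ∀ i, quadrant (pinPoint w i) = 1 ∨ quadrant (pinPoint w i) = 2)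

theorem mixed_ofPinSequence (hr : IsRecurrentFactor [.ru, .ur, .ru] w)
    (hl : IsRecurrentFactor [.lu, .ul, .lu] w) : (ofPinSequence w hw hq).Mixed := by
  intro s
  cases s
  · refine (Nat.frequently_atTop_iff_infinite.2 hl).mono fun i hi => ?_
    have h0 := hi 0 (by simp)
    have h2 := hi 2 (by simp)
    simp at h0 h2
    simp [ofPinSequence, h0, h2]
  · refine (Nat.frequently_atTop_iff_infinite.2 hr).mono fun i hi => ?_
    have h0 := hi 0 (by simp)
    have h2 := hi 2 (by simp)
    simp at h0 h2
    simp [ofPinSequence, h0, h2]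

theorem letter_eq (i : ℕ) : w i =
    if (ofPinSequence w hw hq).up i then
      (if (ofPinSequence w hw hq).right i then .ur else .ul)
    else (if (ofPinSequence w hw hq).right i then .ru else .lu) := by
  rcases letter_cases_of_quadrant hw hq i with h | h | h | h <;> simp [ofPinSequence, h]

/-- Two consecutive sides of horizontal pins determine an antiperiodic sequence. A suffix that
begins with two left horizontal pins is therefore `w22` itself, and such a place recurs because the
sequence is mixed. -/
theorem eventuallyAntiperiodic_iff (hv : (ofPinSequence w hw hq).Mixed) :
    (ofPinSequence w hw hq).EventuallyAntiperiodic ↔ EventuallyEqual w w22 := by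
  constructor
  · intro hE
    obtain ⟨M, hM⟩ := eventually_atTop.1 hE
    obtain ⟨m, hm, hs⟩ := frequently_atTop.1 (hv.frequently_start (false, false, false)) M
    simp only [start, Prod.mk.injEq] at hs
    obtain ⟨hu, h0, h2⟩ := hs
    have hright : ∀ i, (ofPinSequence w hw hq).right (m + i) = decide (2 ≤ i / 2 % 4) := by
      intro i
      induction i using Nat.strong_induction_on with
      | _ i ih =>
        match i with
        | 0 => simpa using h0
        | 1 => simpa [h0] using (ofPinSequence w hw hq).right_succ m hu
        | 2 => simpa using h2
        | 3 =>
          have := (ofPinSequence w hw hq).right_succ (m + 2) (by rw [up_add_two, hu])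
          simpa [h2] using this
        | i + 4 =>
          rw [← add_assoc, hM _ (by omega), ih i (by omega), ← decide_not]
          congr 1
          rw [eq_iff_iff]
          omega
    refine ⟨m, fun i => ?_⟩
    rw [letter_eq hw hq, hright, up_add, hu]
    unfold w22 pinOfBinary
    rcases Nat.mod_two_eq_zero_or_one i with h | h <;> simp [h]
  · rintro ⟨m, hm⟩
    refine eventually_atTop.2 ⟨m, fun i hi => ?_⟩
    obtain ⟨j, rfl⟩ := Nat.exists_eq_add_of_le hi
    have hright : ∀ j, (ofPinSequence w hw hq).right (m + j) = decide (2 ≤ j / 2 % 4) := by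
      intro j
      simp only [ofPinSequence, hm, w22, pinOfBinary]
      rcases Nat.mod_two_eq_zero_or_one j with h | h <;>
        by_cases h' : 2 ≤ j / 2 % 4 <;> simp [h, h']
    rw [add_assoc, hright, hright, ← decide_not]
    congr 1
    rw [eq_iff_iff]
    omega

end PinSequence

end UpperPin

/-! ### The extremal sequence and the quartic -/

theorem isPinSequence_w22 : IsPinSequence w22 := by
  refine ⟨fun i => ?_, fun i => ?_⟩
  · simp only [w22, pinOfBinary]
    split_ifs <;> simp [PinDir.IsHorizontal]
  · have h : i % 2 = 0 → (i + 1) / 2 = i / 2 := by omega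
    rcases Nat.mod_two_eq_zero_or_one i with h0 | h0
    · have h1 : (i + 1) % 2 = 1 := by omega
      simp only [w22, pinOfBinary, h0, h1, h h0]
      by_cases h' : 2 ≤ i / 2 % 4 <;> simp [h']
    · have h1 : (i + 1) % 2 = 0 := by omega
      simp only [w22, pinOfBinary, h0, h1]
      by_cases h' : 2 ≤ i / 2 % 4 <;> by_cases h'' : 2 ≤ (i + 1) / 2 % 4 <;> simp [h', h'']

theorem quadrant_w22 (i : ℕ) : quadrant (pinPoint w22 i) = 1 ∨ quadrant (pinPoint w22 i) = 2 := by
  have e1 : 0 < 2 * (i : ℤ) + 4 := by omega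
  have e2 : 0 < 2 * (i : ℤ) + 1 := by omega
  unfold pinPoint w22 pinOfBinary quadrant
  split_ifs <;> simp_all [PinDir.vec]

theorem isRecurrentFactor_w22 {f : List PinLetter} {m : ℕ}
    (h : ∀ (j : ℕ) (hj : j < f.length), w22 (m + j) = f[j]) : IsRecurrentFactor f w22 := by
  have hper : ∀ t i, w22 (i + 8 * t) = w22 i := by
    intro t i
    have h1 : (i + 8 * t) % 2 = i % 2 := by omega
    have h2 : (i + 8 * t) / 2 % 4 = i / 2 % 4 := by omega
    simp only [w22, pinOfBinary, h1, h2]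
  refine Set.infinite_of_injective_forall_mem (f := fun t => m + 8 * t) (fun a b hab => ?_)
    fun t j hj => ?_
  · simp only at hab
    omega
  · rw [← h j hj, ← hper t (m + j)]
    congr 1
    omega

/-- The dominant root of the polynomial `z ^ 4 - 3 * z ^ 3 - 4 * z - 2`. -/
theorem exists_isGreatest_root : ∃ ν : ℝ,
    IsGreatest {z : ℝ | z ^ 4 - 3 * z ^ 3 - 4 * z - 2 = 0} ν ∧ |ν - 3.39752| ≤ 0.000005 := by
  have hc : ContinuousOn (fun z : ℝ => z ^ 4 - 3 * z ^ 3 - 4 * z - 2)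
      (Set.Icc 3.397515 3.397525) := by fun_prop
  obtain ⟨ν, hν, h⟩ := intermediate_value_Icc (by norm_num) hc
    (show (0 : ℝ) ∈ Set.Icc _ _ by constructor <;> norm_num)
  refine ⟨ν, ⟨h, fun z hz => ?_⟩, ?_⟩
  · by_contra hlt
    push Not at hlt
    have h1 : ν ^ 4 - 3 * ν ^ 3 - 4 * ν - 2 = 0 := h
    have h2 : z ^ 4 - 3 * z ^ 3 - 4 * z - 2 = 0 := hz
    have hν3 : 3.397515 ≤ ν := hν.1
    -- The difference of the two equations is divided by `z - ν`. For `z > ν > 3` the cofactor is at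
    -- least `27 - 4`, so no larger root exists.
    have hfac : (z - ν) * (z ^ 3 + (ν - 3) * (z ^ 2 + z * ν + ν ^ 2) - 4) = 0 := by
      linear_combination h2 - h1
    have hz3 : 3 < z := by linarith
    have hcube : 27 ≤ z ^ 3 := by nlinarith [pow_le_pow_left₀ (by norm_num) hz3.le 3]
    have hpos : 0 ≤ (ν - 3) * (z ^ 2 + z * ν + ν ^ 2) := by
      have : 0 ≤ z * ν := by nlinarith
      exact mul_nonneg (by linarith) (by positivity)
    rcases mul_eq_zero.1 hfac with h0 | h0 <;> linarith
  · rw [abs_le]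
    constructor <;> linarith [hν.1, hν.2]

theorem proposition4p5 :
    ∃ ν : ℝ,
      HasGrowthRate w22 ν ∧
      IsGreatest {z : ℝ | z ^ 4 - 3 * z ^ 3 - 4 * z - 2 = 0} ν ∧
      |ν - 3.39752| ≤ 0.000005 ∧
      ∀ w : ℕ → PinLetter, IsPinSequence w →
        (∀ i, quadrant (pinPoint w i) = 1 ∨ quadrant (pinPoint w i) = 2) →
        IsRecurrentFactor [.ru, .ur, .ru] w →
        IsRecurrentFactor [.lu, .ul, .lu] w →
        ∃ g : ℝ, HasGrowthRate w g ∧ ν ≤ g ∧ (g = ν ↔ EventuallyEqual w w22) := by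
  obtain ⟨ν, hν, happrox⟩ := exists_isGreatest_root
  have hν3 : 10 / 3 < ν := by
    rw [abs_le] at happrox
    linarith [happrox.1]
  have main : ∀ w : ℕ → PinLetter, IsPinSequence w →
      (∀ i, quadrant (pinPoint w i) = 1 ∨ quadrant (pinPoint w i) = 2) →
      IsRecurrentFactor [.ru, .ur, .ru] w → IsRecurrentFactor [.lu, .ul, .lu] w →
      ∃ g : ℝ, HasGrowthRate w g ∧ ν ≤ g ∧ (g = ν ↔ EventuallyEqual w w22) := by
    intro w hw hq hr hl
    have hv := UpperPin.mixed_ofPinSequence hw hq hr hl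
    obtain ⟨g, hg, hle, heq⟩ := hv.exists_growth hν3 hν.1
    refine ⟨g, ?_, hle, heq.trans (UpperPin.eventuallyAntiperiodic_iff hw hq hv)⟩
    simpa only [HasGrowthRate, UpperPin.ncard_pinClass hw hq] using hg
  refine ⟨ν, ?_, hν, happrox, main⟩
  -- `w22` satisfies the hypotheses itself, with `rur` at position 4 and `lul` at position 0, so the
  -- equality case identifies its growth rate as `ν`.
  obtain ⟨g, hg, -, heq⟩ := main w22 isPinSequence_w22 quadrant_w22
    (isRecurrentFactor_w22 (m := 4) fun j hj => by
      simp only [List.length_cons, List.length_nil] at hj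
      interval_cases j <;> rfl)
    (isRecurrentFactor_w22 (m := 0) fun j hj => by
      simp only [List.length_cons, List.length_nil] at hj
      interval_cases j <;> rfl)
  rwa [heq.2 ⟨0, fun i => by rw [zero_add]⟩] at hg
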